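/- All graphs are finite and may have loops and multiple edges. Let $G$ be a connected plane graph, that is, a connected graph with a fixed drawing in the plane: distinct vertices are drawn as distinct points, every edge is drawn as a continuous curve without self-crossings that joins its ends (a closed curve if the edge is a loop), and an edge meets the vertices and the other edges only at its ends. For a spanning tree $T$ of $G$ and an edge $e$ of $T$ let $A_e,B_e$ be the vertex sets of the two components of $T-e$, let $e_G(A_e,B_e)$ be the number of edges of $G$ with one end in $A_e$ and the other in $B_e$, and put $$\mathrm{ec}(G:T)=\max_{e\in E(T)}e_G(A_e,B_e),\qquad s(G)=\min\{\mathrm{ec}(G:T): T \text{ is a spanning tree of } G\}$$ (the first maximum is $0$ if $T$ has no edges). The faces of $G$ are the connected components of the complement of the drawing; the exterior face $O$ is the unbounded one, the other faces are called interior. The dual graph $G^*$ has the faces of $G$ as its vertices and, for every edge $e$ of $G$, one edge $e^*$ which joins the faces on the two sides of $e$ (it is a loop if these coincide). An edge is an outer edge if it occurs in the boundary of $O$ and in the boundary of an interior face. For an outer edge $e$ and an interior face $F$ let $i(F,e)$ be the length of a shortest path in $G^*$ from $O$ to $F$ whose first edge is $e^*$ ($\infty$ if there is no such path). The absolute index of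 an interior face $F$ is $i(F)=\min_e i(F,e)$, the minimum being over all outer edges $e$; for the exterior face put $i(O)=0$. Then all numbers $i(F)$ with $F$ sharing a boundary edge with another face are finite, and $$s(G)\le \max\bigl(i(F)+i(\widetilde F)\bigr)+1,$$ where the maximum is over all pairs $F,\widetilde F$ of distinct faces (the exterior face included) which have a common edge in their boundaries, and is read as $0$ if there is no such pair, that is, if $O$ is the only face. -/

import Mathlib

open scoped Graph unitInterval

noncomputable section

namespace Graph

variable {α β : Type*}

/-! ### Connectedness, trees and spanning tree congestion of (multi)graphs -/

/-- `x` and `y` lie in the same component of `G`. -/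
def Reachable (G : Graph α β) (x y : α) : Prop :=
  x ∈ V(G) ∧ Relation.ReflTransGen G.Adj x y

/-- A graph is connected if it has a vertex and any two vertices are joined by a walk. -/
def IsConnected (G : Graph α β) : Prop :=
  V(G).Nonempty ∧ ∀ x ∈ V(G), ∀ y ∈ V(G), G.Reachable x y

/-- `v 0, f 0, v 1, f 1, …, f (n - 1), v n = v 0` is a cycle of length `n ≥ 1` in `G`: its
vertices `v 0, …, v (n - 1)` are distinct and so are its edges. Loops are cycles of length `1`,
pairs of parallel edges are cycles of length `2`. -/
structure IsCycle (G : Graph α β) (n : ℕ) (v : ℕ → α) (f : ℕ → β) : Prop where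
  pos : 0 < n
  isLink : ∀ k < n, G.IsLink (f k) (v k) (v (k + 1))
  closed : v n = v 0
  vertex_injOn : Set.InjOn v (Set.Iio n)
  edge_injOn : Set.InjOn f (Set.Iio n)

/-- A tree is a connected graph without cycles. -/
def IsTree (T : Graph α β) : Prop :=
  T.IsConnected ∧ ∀ n v f, ¬ T.IsCycle n v f

/-- `T` is a spanning tree of `G`. -/
def IsSpanningTree (T G : Graph α β) : Prop :=
  T ≤s G ∧ T.IsTree

/-- The vertex set of the component of `x` in `G`. -/
def component (G : Graph α β) (x : α) : Set α := {y | G.Reachable x y}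

/-- The edges of `G` with one end in `A_e` and the other end in `B_e`, where `A_e` and `B_e` are
the components, in `T - e`, of the two ends of the edge `e` of `T`. -/
def congestionSet (G T : Graph α β) (e : β) : Set β :=
  {g | ∃ x y, T.IsLink e x y ∧ ∃ a ∈ (T.deleteEdges {e}).component x,
    ∃ b ∈ (T.deleteEdges {e}).component y, G.IsLink g a b}

/-- The edge congestion `ec(G : T)`: the maximum over the edges `e` of `T` of the number
`e_G(A_e, B_e)`. -/
def edgeCongestion (G T : Graph α β) : ℕ∞ :=
  ⨆ e ∈ E(T), (G.congestionSet T e).encard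

/-- The spanning tree congestion `s(G)`: the minimum of `ec(G : T)` over the spanning trees. -/
def spanningTreeCongestion (G : Graph α β) : ℕ∞ :=
  ⨅ (T : Graph α β) (_ : T.IsSpanningTree G), G.edgeCongestion T

/-- `G` contains a path (without repeated vertices) of length `n ≥ 1` from `x` to `y` whose
first edge is `e`. -/
def HasPathWithFirstEdge (G : Graph α β) (x y : α) (e : β) (n : ℕ) : Prop :=
  ∃ (v : ℕ → α) (f : ℕ → β), 0 < n ∧ v 0 = x ∧ v n = y ∧ f 0 = e ∧
    Set.InjOn v (Set.Iic n) ∧ ∀ k < n, G.IsLink (f k) (v k) (v (k + 1))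

/-! ### Plane graphs -/

/-- A drawing of the graph `G` in the plane, the latter taken to be `ℂ`. Distinct vertices are
drawn as distinct points; every edge is drawn as a continuous curve which joins the points of its
two ends, has no self-crossings, and meets the rest of the drawing only at its ends. The curve of a
loop is closed. -/
structure PlaneDrawing (G : Graph α β) where
  /-- The position of a vertex. -/
  point : α → ℂ
  /-- The parametrized curve that represents an edge. -/
  curve : β → I → ℂ
  point_injOn : Set.InjOn point V(G)
  curve_continuous : ∀ e ∈ E(G), Continuous (curve e)
  curve_ends : ∀ e ∈ E(G), ∃ x y, G.IsLink e x y ∧ curve e 0 = point x ∧ curve e 1 = point y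
  curve_injOn : ∀ e ∈ E(G), Set.InjOn (curve e) (Set.Ioo 0 1)
  curve_ne_point : ∀ e ∈ E(G), ∀ t ∈ Set.Ioo (0 : I) 1, ∀ x ∈ V(G), curve e t ≠ point x
  curve_disjoint : ∀ e ∈ E(G), ∀ e' ∈ E(G), e ≠ e' →
    Disjoint (curve e '' Set.Ioo 0 1) (curve e' '' Set.Ioo 0 1)

namespace PlaneDrawing

variable {G : Graph α β} (D : PlaneDrawing G)

/-- The set of points of the plane occupied by the drawing. -/
def support : Set ℂ := D.point '' V(G) ∪ ⋃ e ∈ E(G), Set.range (D.curve e)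

/-- The faces are the connected components of the complement of the drawing. -/
def IsFace (F : Set ℂ) : Prop :=
  ∃ z ∈ D.supportᶜ, F = connectedComponentIn D.supportᶜ z

/-- The exterior face is the unbounded one. -/
def IsExteriorFace (F : Set ℂ) : Prop := D.IsFace F ∧ ¬ Bornology.IsBounded F

/-- The interior faces are the bounded ones. -/
def IsInteriorFace (F : Set ℂ) : Prop := D.IsFace F ∧ Bornology.IsBounded F

/-- The edge `e` occurs in the boundary of `F`. -/
def IsBoundaryEdge (e : β) (F : Set ℂ) : Prop :=
  e ∈ E(G) ∧ Set.range (D.curve e) ⊆ frontier F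

/-- The dual graph `G*`. Its vertices are the faces, and the edge `e*` (labelled by `e` itself)
joins the faces on the two sides of `e`: these are `F` and `F'` if the faces having `e` in their
boundary are exactly `F` and `F'`. If this is a single face, `e*` is a loop. -/
def dual : Graph (Set ℂ) β where
  vertexSet := {F | D.IsFace F}
  IsLink e F F' := e ∈ E(G) ∧ D.IsFace F ∧ D.IsFace F' ∧
    ∀ H, D.IsFace H → (D.IsBoundaryEdge e H ↔ H = F ∨ H = F')
  isLink_symm := fun _ _ => ⟨fun _ _ h =>
    ⟨h.1, h.2.2.1, h.2.1, fun H hH => (h.2.2.2 H hH).trans or_comm⟩⟩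
  eq_or_eq_of_isLink_of_isLink := fun _ F _ _ _ h h' =>
    (h'.2.2.2 F h.2.1).1 ((h.2.2.2 F h.2.1).2 (Or.inl rfl))
  left_mem_of_isLink := fun _ _ _ h => h.2.1

/-- An outer edge occurs in the boundary of the exterior face and of an interior face. -/
def IsOuterEdge (e : β) : Prop :=
  (∃ O, D.IsExteriorFace O ∧ D.IsBoundaryEdge e O) ∧
    ∃ F, D.IsInteriorFace F ∧ D.IsBoundaryEdge e F

/-- The index `i(F, e)`: the length of a shortest path in `G*` which joins the exterior face
with `F` and has `e*` as its first edge (`⊤` if there is no such path). -/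
def index (F : Set ℂ) (e : β) : ℕ∞ :=
  ⨅ (O : Set ℂ) (_ : D.IsExteriorFace O) (n : ℕ) (_ : D.dual.HasPathWithFirstEdge O F e n), (n : ℕ∞)

open Classical in
/-- The absolute index `i(F)`: the minimum of `i(F, e)` over the outer edges `e` if `F` is an
interior face, and `0` if `F` is the exterior face. -/
def absoluteIndex (F : Set ℂ) : ℕ∞ :=
  if D.IsExteriorFace F then 0 else ⨅ (e : β) (_ : D.IsOuterEdge e), D.index F e

/-- `F` and `F'` are distinct faces which have a common edge in their boundaries. -/
def AreAdjacentFaces (F F' : Set ℂ) : Prop :=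
  D.IsFace F ∧ D.IsFace F' ∧ F ≠ F' ∧ ∃ e, D.IsBoundaryEdge e F ∧ D.IsBoundaryEdge e F'

/-- The maximum of `i(F) + i(F')` over all pairs of faces which have a common edge in their
boundaries (and `0` if there is no such pair, that is, if there is only one face). -/
def maxIndexSum : ℕ∞ :=
  ⨆ (F : Set ℂ) (F' : Set ℂ) (_ : D.AreAdjacentFaces F F'), (D.absoluteIndex F + D.absoluteIndex F')

end PlaneDrawing

end Graph

end

/-!
The spanning tree is complementary to a shortest-path tree of the dual graph. Let `τ` be such a
tree, rooted at the exterior face `O`, and let `T` consist of the edges of `G` whose dual edges are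
not in `τ`. Since cycles separate the plane and forests do not, `T` is a spanning tree. If `e` is an
edge of `T` between the faces `F` and `F'`, then the other edges of `G` between the two components
of `T - e` are dual to edges of the cycle that `e*` closes in `τ`. These lie on the two ways from
`F` and `F'` to the root, whose lengths are the distances from `O` in the dual graph, that is,
`i(F)` and `i(F')`.

The topology of the plane enters through continuous logarithms. A compact set `K` does not separate
`p` from `q` if and only if `(z - q) / (z - p)` has a continuous logarithm on `K`, and logarithms on
two compact sets can be glued if the sets have a connected intersection.
-/

namespace PlaneTopology

open Set Topology Bornology Complex

section Logarithm

variable {X : Type*} [TopologicalSpace X] {f f' : X → ℂ} {K A B : Set X}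

/-- The function `f` has a continuous logarithm on `K`. The obstructions to its existence detect
how compact sets separate the plane. -/
def HasLogOn (f : X → ℂ) (K : Set X) : Prop :=
  ∃ g : X → ℂ, ContinuousOn g K ∧ ∀ x ∈ K, exp (g x) = f x

theorem HasLogOn.mono (h : HasLogOn f K) (hA : A ⊆ K) : HasLogOn f A :=
  let ⟨g, hg, hgf⟩ := h
  ⟨g, hg.mono hA, fun x hx => hgf x (hA hx)⟩

theorem HasLogOn.congr (h : HasLogOn f K) (h' : EqOn f f' K) : HasLogOn f' K :=
  let ⟨g, hg, hgf⟩ := h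
  ⟨g, hg, fun x hx => (hgf x hx).trans (h' hx)⟩

theorem HasLogOn.comp {Y : Type*} [TopologicalSpace Y] {φ : Y → X} {C : Set Y} (h : HasLogOn f K)
    (hφ : ContinuousOn φ C) (hK : MapsTo φ C K) : HasLogOn (f ∘ φ) C :=
  let ⟨g, hg, hgf⟩ := h
  ⟨g ∘ φ, hg.comp hφ hK, fun y hy => hgf (φ y) (hK hy)⟩

theorem HasLogOn.image [T2Space X] {Y : Type*} [TopologicalSpace Y] {φ : Y → X} {C : Set Y}
    (h : HasLogOn (f ∘ φ) C) (hC : IsCompact C) (hφ : ContinuousOn φ C) (hinj : InjOn φ C) :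
    HasLogOn f (φ '' C) := by
  obtain ⟨g, hg, hgf⟩ := h
  rcases isEmpty_or_nonempty Y with _ | _
  · exact ⟨0, continuousOn_const, by rintro _ ⟨y, -, -⟩; exact isEmptyElim y⟩
  have hinv : ∀ y ∈ C, Function.invFunOn φ C (φ y) = y := fun y hy => hinj.leftInvOn_invFunOn hy
  refine ⟨g ∘ Function.invFunOn φ C, ?_, ?_⟩
  · have : CompactSpace C := isCompact_iff_compactSpace.1 hC
    have hπ : Continuous (imageFactorization φ C) := hφ.mapsToRestrict (mapsTo_image φ C)
    have hquot : IsQuotientMap (imageFactorization φ C) :=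
      hπ.isClosedMap.isQuotientMap hπ imageFactorization_surjective
    rw [continuousOn_iff_continuous_domRestrict, hquot.continuous_iff]
    refine hg.domRestrict.congr fun y => ?_
    simp [domRestrict, imageFactorization, hinv y y.2]
  · rintro _ ⟨y, hy, rfl⟩
    rw [Function.comp_apply, hinv y hy]
    exact hgf y hy

theorem sub_eq_sub_of_exp_eq_mul_exp (hK : IsPreconnected K) {g h : X → ℂ}
    (hg : ContinuousOn g K) (hh : ContinuousOn h K) {c : ℂ}
    (hgh : ∀ x ∈ K, exp (g x) = c * exp (h x)) {x y : X} (hx : x ∈ K) (hy : y ∈ K) :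
    g y - g x = h y - h x := by
  have hlift : EqOn g (fun z => h z + (g x - h x)) K := by
    refine isCoveringMap_exp.eqOn_of_comp_eqOn hK hg (hh.add continuousOn_const)
      (fun z hz => Subtype.ext ?_) hx (by ring)
    change exp (g z) = exp (h z + (g x - h x))
    rw [exp_add, exp_sub, hgh z hz, hgh x hx]
    field_simp [exp_ne_zero (h x)]
  rw [hlift hy]
  ring

theorem exists_continuousOn_union {E : Type*} [TopologicalSpace E] {g h : X → E}
    (hg : ContinuousOn g A) (hh : ContinuousOn h B) (hgh : EqOn g h (A ∩ B))
    (hglue : ∀ k : X → E, ContinuousOn k A → ContinuousOn k B → ContinuousOn k (A ∪ B)) :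
    ∃ k : X → E, ContinuousOn k (A ∪ B) ∧ EqOn k g A ∧ EqOn k h B := by
  classical
  have hkA : EqOn (A.piecewise g h) g A := piecewise_eqOn A g h
  have hkB : EqOn (A.piecewise g h) h B := fun x hx => by
    by_cases hxA : x ∈ A
    · rw [hkA hxA, hgh ⟨hxA, hx⟩]
    · rw [piecewise_eq_of_notMem A g h hxA]
  exact ⟨A.piecewise g h, hglue _ (hg.congr hkA) (hh.congr hkB), hkA, hkB⟩

theorem HasLogOn.union (hA : HasLogOn f A) (hB : HasLogOn f B) (hAB : IsPreconnected (A ∩ B))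
    (hglue : ∀ k : X → ℂ, ContinuousOn k A → ContinuousOn k B → ContinuousOn k (A ∪ B)) :
    HasLogOn f (A ∪ B) := by
  obtain ⟨g, hg, hgf⟩ := hA
  obtain ⟨h, hh, hhf⟩ := hB
  obtain ⟨c, hc, hgh⟩ : ∃ c, exp c = 1 ∧ ∀ x ∈ A ∩ B, g x = h x + c := by
    rcases (A ∩ B).eq_empty_or_nonempty with h0 | ⟨x, hx⟩
    · exact ⟨0, exp_zero, by simp [h0]⟩
    refine ⟨g x - h x, ?_, fun y hy => ?_⟩
    · rw [exp_sub, hgf x hx.1, hhf x hx.2, div_self (hgf x hx.1 ▸ exp_ne_zero _)]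
    · linear_combination sub_eq_sub_of_exp_eq_mul_exp hAB (hg.mono inter_subset_left)
        (hh.mono inter_subset_right) (c := 1) (fun z hz => by rw [hgf z hz.1, hhf z hz.2, one_mul])
        hx hy
  obtain ⟨k, hk, hkA, hkB⟩ := exists_continuousOn_union hg (hh.add continuousOn_const) hgh hglue
  refine ⟨k, hk, ?_⟩
  rintro x (hx | hx)
  · rw [hkA hx, hgf x hx]
  · simp only [hkB hx, Pi.add_apply, exp_add, hc, hhf x hx, mul_one]

theorem exists_logs_eq_add_int_mul (hA : HasLogOn f A) (hB : HasLogOn f B) {x y : X}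
    (hx : x ∈ A ∩ B) (hy : y ∈ A ∩ B) : ∃ (g h : X → ℂ) (k : ℤ),
      ContinuousOn g A ∧ ContinuousOn h B ∧ (∀ z ∈ A, exp (g z) = f z) ∧
      (∀ z ∈ B, exp (h z) = f z) ∧ g x = h x ∧ g y = h y + k * (2 * Real.pi * Complex.I) := by
  obtain ⟨g, hg, hgf⟩ := hA
  obtain ⟨h, hh, hhf⟩ := hB
  obtain ⟨i, hi⟩ := exp_eq_exp_iff_exists_int.1 ((hgf x hx.1).trans (hhf x hx.2).symm)
  obtain ⟨j, hj⟩ := exp_eq_exp_iff_exists_int.1 ((hgf y hy.1).trans (hhf y hy.2).symm)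
  refine ⟨g, fun z => h z + i * (2 * Real.pi * Complex.I), j - i, hg, hh.add continuousOn_const,
    hgf, fun z hz => ?_, hi, ?_⟩
  · rw [exp_add, exp_int_mul_two_pi_mul_I, hhf z hz, mul_one]
  · rw [hj]
    push_cast
    ring

-- The logarithms of `f` on `A` and `B` that agree at `x` differ by `2πik` at `y`, those of `f'` by
-- `2πik'`; their combination with `m k + n k' = 0` agrees at both points.
theorem exists_hasLogOn_union_zpow_mul_zpow (hA : HasLogOn f A) (hB : HasLogOn f B)
    (hA' : HasLogOn f' A) (hB' : HasLogOn f' B) {x y : X} (hAB : A ∩ B = {x, y})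
    (hglue : ∀ k : X → ℂ, ContinuousOn k A → ContinuousOn k B → ContinuousOn k (A ∪ B)) :
    ∃ m n : ℤ, (m ≠ 0 ∨ n ≠ 0) ∧ HasLogOn (fun z => f z ^ m * f' z ^ n) (A ∪ B) := by
  have hxAB : x ∈ A ∩ B := hAB ▸ mem_insert x {y}
  have hyAB : y ∈ A ∩ B := hAB ▸ mem_insert_of_mem x rfl
  obtain ⟨g, h, k, hg, hh, hgf, hhf, hx, hy⟩ := exists_logs_eq_add_int_mul hA hB hxAB hyAB
  obtain ⟨g', h', k', hg', hh', hgf', hhf', hx', hy'⟩ :=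
    exists_logs_eq_add_int_mul hA' hB' hxAB hyAB
  obtain ⟨m, n, hmn, hk⟩ : ∃ m n : ℤ, (m ≠ 0 ∨ n ≠ 0) ∧ m * k + n * k' = 0 := by
    by_cases hk' : k' = 0
    · exact ⟨0, 1, Or.inr one_ne_zero, by simp [hk']⟩
    · exact ⟨k', -k, Or.inl hk', by ring⟩
  have hkℂ : (m * k + n * k' : ℂ) = 0 := mod_cast hk
  obtain ⟨l, hl, hlA, hlB⟩ := exists_continuousOn_union
    (g := fun z => m * g z + n * g' z) (h := fun z => m * h z + n * h' z)
    ((continuousOn_const.mul hg).add (continuousOn_const.mul hg'))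
    ((continuousOn_const.mul hh).add (continuousOn_const.mul hh')) (by
      rw [hAB]
      rintro z (rfl | rfl)
      · simp only [hx, hx']
      · simp only [hy, hy']
        linear_combination (2 * Real.pi * Complex.I) * hkℂ) hglue
  refine ⟨m, n, hmn, l, hl, ?_⟩
  rintro z (hz | hz)
  · simp only [hlA hz, exp_add, exp_int_mul, hgf z hz, hgf' z hz]
  · simp only [hlB hz, exp_add, exp_int_mul, hhf z hz, hhf' z hz]

theorem hasLogOn_univ [SimplyConnectedSpace X] [LocallyPathConnectedSpace X] (hf : Continuous f)
    (hf0 : ∀ x, f x ≠ 0) : HasLogOn f univ := by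
  obtain ⟨x⟩ : Nonempty X := inferInstance
  obtain ⟨g, ⟨-, hg⟩, -⟩ := isCoveringMap_exp.existsUnique_continuousMap_lifts
    ⟨fun x => ⟨f x, hf0 x⟩, hf.subtype_mk _⟩ x (log (f x)) (Subtype.ext (exp_log (hf0 x)))
  exact ⟨g, g.continuous.continuousOn, fun x _ => congrArg Subtype.val (congrFun hg x)⟩

theorem hasLogOn_Icc {f : I → ℂ} {s t : I} (hf : ContinuousOn f (Icc s t))
    (hf0 : ∀ u ∈ Icc s t, f u ≠ 0) : HasLogOn f (Icc s t) := by
  rcases le_or_gt s t with hst | hst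
  · let c : ℝ → Icc s t := projIcc s t hst ∘ projIcc 0 1 zero_le_one
    have hc : Continuous c := continuous_projIcc.comp continuous_projIcc
    have hlog : HasLogOn (fun x => f (c x)) univ :=
      hasLogOn_univ (hf.domRestrict.comp hc) fun x => hf0 _ (c x).2
    refine (hlog.comp continuous_subtype_val.continuousOn (mapsTo_univ _ _)).congr fun u hu => ?_
    simp [c, projIcc_of_mem hst hu]
  · exact ⟨0, continuousOn_const, by simp [hst]⟩

theorem hasLogOn_image_Icc [T2Space X] {γ : I → X} (hγ : Continuous γ) {s t : I}
    (hinj : InjOn γ (Icc s t)) (hf : ContinuousOn f (γ '' Icc s t))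
    (hf0 : ∀ x ∈ γ '' Icc s t, f x ≠ 0) : HasLogOn f (γ '' Icc s t) :=
  (hasLogOn_Icc (hf.comp hγ.continuousOn (mapsTo_image _ _)) fun _ hu =>
    hf0 _ (mem_image_of_mem γ hu)).image isCompact_Icc hγ.continuousOn hinj

theorem exists_continuous_exp_eq_of_homotopy {f : I × X → ℂ} (hf : Continuous f)
    (hf0 : ∀ z, f z ≠ 0) (h0 : ∀ x, f (0, x) = 1) :
    ∃ g : X → ℂ, Continuous g ∧ ∀ x, exp (g x) = f (1, x) := by
  have hstart : ∀ x, (⟨f (0, x), hf0 _⟩ : {w : ℂ // w ≠ 0}) =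
      ⟨exp ((0 : C(X, ℂ)) x), exp_ne_zero _⟩ := fun x => Subtype.ext (by simp [h0])
  have hlift :=
    isCoveringMap_exp.liftHomotopy_lifts ⟨fun z => ⟨f z, hf0 z⟩, hf.subtype_mk _⟩ 0 hstart
  exact ⟨_, (isCoveringMap_exp.liftHomotopy _ 0 hstart).continuous.comp (Continuous.prodMk_right 1),
    fun x => congrArg Subtype.val (congrFun hlift (1, x))⟩

-- Along a path `γ` off `K`, the functions `(z - γ t) / (z - p)` deform the constant `1`, whose
-- logarithm is `0`; covering homotopies lift the deformation.
theorem hasLogOn_div_of_joinedIn {K : Set ℂ} {p q : ℂ} (h : JoinedIn Kᶜ p q) :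
    HasLogOn (fun z => (z - q) / (z - p)) K := by
  classical
  obtain ⟨γ, hγ⟩ := h
  have hne : ∀ (t : I) (z : K), (z : ℂ) - γ t ≠ 0 := fun t z hz =>
    hγ t (sub_eq_zero.1 hz ▸ z.2)
  have hp : ∀ z : K, (z : ℂ) - p ≠ 0 := fun z => by simpa using hne 0 z
  obtain ⟨g, hg, hgf⟩ := exists_continuous_exp_eq_of_homotopy (X := K)
    (f := fun x => (x.2 - γ x.1) / (x.2 - p))
    (Continuous.div (by fun_prop) (by fun_prop) fun x => hp x.2)
    (fun x => div_ne_zero (hne _ _) (hp _)) fun z => by simp [div_self (hp z)]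
  refine ⟨fun z => if hz : z ∈ K then g ⟨z, hz⟩ else 0, ?_, fun z hz => ?_⟩
  · rw [continuousOn_iff_continuous_domRestrict]
    exact hg.congr fun z => by simp
  · simpa [hz] using hgf ⟨z, hz⟩

end Logarithm

theorem eq_zero_of_hasLogOn_zpow_sphere {p : ℂ} {r : ℝ} (hr : 0 < r) {n : ℤ}
    (h : HasLogOn (fun z => (z - p) ^ n) (Metric.sphere p r)) : n = 0 := by
  obtain ⟨g, hg, hgn⟩ := h
  have hmem : ∀ θ, circleMap p r θ ∈ Metric.sphere p r := circleMap_mem_sphere p hr.le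
  have hgc : Continuous fun θ => g (circleMap p r θ) :=
    hg.comp_continuous (continuous_circleMap p r) hmem
  have hexp : ∀ θ : ℝ, exp (g (circleMap p r θ)) = (r : ℂ) ^ n * exp (n * (θ * Complex.I)) :=
    fun θ => by
      rw [hgn _ (hmem θ)]
      simp [circleMap, exp_int_mul, mul_zpow]
  have hperiod := sub_eq_sub_of_exp_eq_mul_exp (isPreconnected_univ (α := ℝ)) hgc.continuousOn
    (by fun_prop) (fun θ _ => hexp θ) (mem_univ 0) (mem_univ (2 * Real.pi))
  rw [show circleMap p r (2 * Real.pi) = circleMap p r 0 by simp [circleMap]] at hperiod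
  simpa [Real.pi_ne_zero] using hperiod

/-! ### Components of the complement of a compact set -/

-- Otherwise the logarithm, extended over the plane, would turn `(z - p) ^ n` outside `U` and a
-- nonvanishing function inside `U` into one nonvanishing function on the plane, whose logarithm
-- would restrict to a large circle around `p`.
theorem eq_zero_of_hasLogOn_zpow_mul {K U : Set ℂ} (hK : IsClosed K) (hU : IsOpen U)
    (hUb : IsBounded U) (hUK : frontier U ⊆ K) {p : ℂ} (hp : p ∈ U) {n : ℤ}
    {f : ℂ → ℂ} (hf : ContinuousOn f (closure U)) (hf0 : ∀ z ∈ closure U, f z ≠ 0)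
    (hlog : HasLogOn (fun z => (z - p) ^ n * f z) K) : n = 0 := by
  classical
  obtain ⟨g, hg, hgf⟩ := hlog
  obtain ⟨G, hG⟩ := ContinuousMap.exists_restrict_eq hK ⟨K.domRestrict g, hg.domRestrict⟩
  have hGg : ∀ z ∈ K, G z = g z := fun z hz => congrFun (congrArg DFunLike.coe hG) ⟨z, hz⟩
  have hne : ∀ z, z ∉ U → z - p ≠ 0 := fun z hz h => hz (by rwa [sub_eq_zero.1 h])
  let k : ℂ → ℂ := U.piecewise (fun z => exp (-(G z)) * f z) (fun z => ((z - p) ^ n)⁻¹)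
  have hk : Continuous k := by
    refine continuous_piecewise (fun z hz => ?_) ?_ ?_
    · have hzp := zpow_ne_zero n (hne z (hU.frontier_eq ▸ hz).2)
      have hfz := hf0 z (frontier_subset_closure hz)
      rw [exp_neg, hGg z (hUK hz), hgf z (hUK hz)]
      field_simp
    · exact (by fun_prop : Continuous fun z => exp (-(G z))).continuousOn.mul hf
    · rw [hU.isClosed_compl.closure_eq]
      exact ((continuousOn_id.sub continuousOn_const).zpow₀ n fun z hz => Or.inl (hne z hz)).inv₀
        fun z hz => zpow_ne_zero n (hne z hz)
  have hk0 : ∀ z, k z ≠ 0 := by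
    intro z
    by_cases hz : z ∈ U
    · simp [k, hz, hf0 z (subset_closure hz)]
    · simpa [k, hz] using zpow_ne_zero n (hne z hz)
  obtain ⟨F, hF, hFk⟩ := hasLogOn_univ hk hk0
  obtain ⟨r, hr, hrU⟩ := hUb.subset_ball_lt 0 p
  refine eq_zero_of_hasLogOn_zpow_sphere hr (p := p)
    ⟨fun z => -F z, (hF.mono (subset_univ _)).neg, fun z hz => ?_⟩
  have hzU : z ∉ U := fun h => (Metric.mem_ball.1 (hrU h)).ne (Metric.mem_sphere.1 hz)
  rw [exp_neg, hFk z (mem_univ z)]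
  simp [k, hzU]

theorem frontier_connectedComponentIn_compl_subset {X : Type*} [TopologicalSpace X]
    [LocallyConnectedSpace X] {K : Set X} (hK : IsClosed K) (p : X) :
    frontier (connectedComponentIn Kᶜ p) ⊆ K := by
  intro z hz
  by_contra hzK
  rw [hK.isOpen_compl.connectedComponentIn.frontier_eq] at hz
  obtain ⟨y, hyz, hyp⟩ := mem_closure_iff.1 hz.1 _ hK.isOpen_compl.connectedComponentIn
    (mem_connectedComponentIn (F := Kᶜ) hzK)
  apply hz.2
  rw [connectedComponentIn_eq hyp, ← connectedComponentIn_eq hyz]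
  exact mem_connectedComponentIn hzK

theorem isPreconnected_compl_closedBall (r : ℝ) :
    IsPreconnected (Metric.closedBall (0 : ℂ) r)ᶜ := by
  have hpolar : (Metric.closedBall (0 : ℂ) r)ᶜ =
      (fun x : ℝ × ℝ => (x.1 : ℂ) * exp (x.2 * Complex.I)) '' (Ioi r ×ˢ univ) := by
    ext z
    simp only [mem_compl_iff, Metric.mem_closedBall, dist_zero_right, not_le, mem_image, mem_prod,
      mem_Ioi, mem_univ, and_true, Prod.exists]
    refine ⟨fun h => ⟨‖z‖, arg z, h, norm_mul_exp_arg_mul_I z⟩, ?_⟩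
    rintro ⟨a, b, h, rfl⟩
    simpa [norm_exp_ofReal_mul_I] using h.trans_le (le_abs_self a)
  rw [hpolar]
  exact (isPreconnected_Ioi.prod isPreconnected_univ).image _ (by fun_prop)

theorem not_isBounded_compl_closedBall (r : ℝ) :
    ¬ IsBounded (Metric.closedBall (0 : ℂ) r)ᶜ := fun h =>
  NormedSpace.unbounded_univ ℝ ℂ <| compl_union_self (Metric.closedBall (0 : ℂ) r) ▸
    h.union Metric.isBounded_closedBall

theorem connectedComponentIn_eq_of_not_isBounded {K : Set ℂ} (hK : IsBounded K) {p q : ℂ}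
    (hp : ¬ IsBounded (connectedComponentIn Kᶜ p))
    (hq : ¬ IsBounded (connectedComponentIn Kᶜ q)) :
    connectedComponentIn Kᶜ p = connectedComponentIn Kᶜ q := by
  obtain ⟨r, hr⟩ := hK.subset_closedBall 0
  have hfar : ∀ p, ¬ IsBounded (connectedComponentIn Kᶜ p) →
      ∃ x ∈ connectedComponentIn Kᶜ p, x ∈ (Metric.closedBall 0 r)ᶜ := by
    intro p hp
    by_contra! h
    exact hp (Metric.isBounded_closedBall.subset fun x hx => notMem_compl_iff.1 (h x hx))
  obtain ⟨x, hxp, hxr⟩ := hfar p hp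
  obtain ⟨y, hyq, hyr⟩ := hfar q hq
  rw [connectedComponentIn_eq hxp, connectedComponentIn_eq hyq]
  exact connectedComponentIn_eq <| (isPreconnected_compl_closedBall r).subset_connectedComponentIn
    hxr (compl_subset_compl.2 hr) hyr

theorem exists_not_isBounded_connectedComponentIn {K : Set ℂ} (hK : IsBounded K) :
    ∃ p ∈ Kᶜ, ¬ IsBounded (connectedComponentIn Kᶜ p) := by
  obtain ⟨r, hr⟩ := hK.subset_closedBall 0
  have hout : (Metric.closedBall (0 : ℂ) r)ᶜ ⊆ Kᶜ := compl_subset_compl.2 hr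
  obtain ⟨p, hp⟩ : (Metric.closedBall (0 : ℂ) r)ᶜ.Nonempty :=
    nonempty_iff_ne_empty.2 fun h => not_isBounded_compl_closedBall r (h ▸ isBounded_empty)
  exact ⟨p, hout hp, fun hb => not_isBounded_compl_closedBall r <|
    hb.subset ((isPreconnected_compl_closedBall r).subset_connectedComponentIn hp hout)⟩

/-- **Eilenberg's criterion**. -/
theorem eq_zero_of_hasLogOn_prod_zpow {K : Set ℂ} (hK : IsCompact K) {ι : Type*} [Fintype ι]
    {p : ι → ℂ} (hp : ∀ i, p i ∉ K)
    (hinj : Function.Injective fun i => connectedComponentIn Kᶜ (p i)) {n : ι → ℤ}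
    (hsum : ∑ i, n i = 0) (hlog : HasLogOn (fun z => ∏ i, (z - p i) ^ n i) K) : n = 0 := by
  classical
  have hbdd : ∀ i, IsBounded (connectedComponentIn Kᶜ (p i)) → n i = 0 := by
    intro i hi
    have hne : ∀ j ∈ Finset.univ.erase i, ∀ z ∈ closure (connectedComponentIn Kᶜ (p i)),
        z - p j ≠ 0 := by
      intro j hj z hz hzj
      rw [sub_eq_zero.1 hzj, closure_eq_self_union_frontier] at hz
      exact hz.elim (fun h => Finset.ne_of_mem_erase hj (hinj (connectedComponentIn_eq h).symm))
        fun h => hp j (frontier_connectedComponentIn_compl_subset hK.isClosed _ h)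
    refine eq_zero_of_hasLogOn_zpow_mul hK.isClosed hK.isClosed.isOpen_compl.connectedComponentIn
      hi (frontier_connectedComponentIn_compl_subset hK.isClosed _)
      (mem_connectedComponentIn (hp i)) (f := fun z => ∏ j ∈ Finset.univ.erase i, (z - p j) ^ n j)
      (continuousOn_finsetProd _ fun j hj =>
        (continuousOn_id.sub continuousOn_const).zpow₀ _ fun z hz => Or.inl (hne j hj z hz))
      (fun z hz => Finset.prod_ne_zero_iff.2 fun j hj => zpow_ne_zero _ (hne j hj z hz))
      (hlog.congr fun z _ => (Finset.mul_prod_erase _ _ (Finset.mem_univ i)).symm)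
  funext i
  by_contra hi
  refine hi ((Fintype.sum_eq_single i fun j hj => hbdd j ?_).symm.trans hsum)
  by_contra hjb
  exact hj (hinj (connectedComponentIn_eq_of_not_isBounded hK.isBounded hjb fun hb =>
    hi (hbdd i hb)))

theorem joinedIn_iff_mem_connectedComponentIn {X : Type*} [TopologicalSpace X]
    [LocallyPathConnectedSpace X] {U : Set X} (hU : IsOpen U) {p q : X} (hp : p ∈ U) :
    JoinedIn U p q ↔ q ∈ connectedComponentIn U p := by
  refine ⟨fun h => ?_, fun h => ?_⟩
  · have hpre := (isPathConnected_pathComponentIn hp).isConnected.isPreconnected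
    exact hpre.subset_connectedComponentIn (mem_pathComponentIn_self hp) pathComponentIn_subset h
  · have hpath := hU.connectedComponentIn.isConnected_iff_isPathConnected.1
      (isConnected_connectedComponentIn_iff.2 hp)
    exact (hpath.joinedIn p (mem_connectedComponentIn hp) q h).mono
      (connectedComponentIn_subset U p)

theorem joinedIn_of_connectedComponentIn_eq {X : Type*} [TopologicalSpace X]
    [LocallyPathConnectedSpace X] {U : Set X} (hU : IsOpen U) {p q : X} (hp : p ∈ U) (hq : q ∈ U)
    (h : connectedComponentIn U p = connectedComponentIn U q) : JoinedIn U p q :=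
  (joinedIn_iff_mem_connectedComponentIn hU hp).2 (h ▸ mem_connectedComponentIn hq)

theorem isPreconnected_iff_forall_joinedIn {X : Type*} [TopologicalSpace X]
    [LocallyPathConnectedSpace X] {U : Set X} (hU : IsOpen U) :
    IsPreconnected U ↔ ∀ p ∈ U, ∀ q ∈ U, JoinedIn U p q := by
  refine ⟨fun h p hp q hq => ?_, fun h => ?_⟩
  · exact (joinedIn_iff_mem_connectedComponentIn hU hp).2 (by rwa [h.connectedComponentIn hp])
  · rcases U.eq_empty_or_nonempty with rfl | ⟨p, hp⟩
    · exact isPreconnected_empty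
    · exact IsPathConnected.isConnected ⟨p, hp, fun {q} hq => h p hp q hq⟩ |>.isPreconnected

theorem joinedIn_compl_of_hasLogOn {K : Set ℂ} (hK : IsCompact K) {p q : ℂ} (hp : p ∉ K)
    (hq : q ∉ K) (hlog : HasLogOn (fun z => (z - q) / (z - p)) K) : JoinedIn Kᶜ p q := by
  refine joinedIn_of_connectedComponentIn_eq hK.isClosed.isOpen_compl hp hq ?_
  by_contra hne
  have := eq_zero_of_hasLogOn_prod_zpow hK (p := ![p, q]) (n := ![-1, 1])
    (Fin.forall_fin_two.2 ⟨hp, hq⟩)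
    (by simp [Function.Injective, Fin.forall_fin_two, hne, Ne.symm hne]) (by simp)
    (hlog.congr fun z _ => by simp [Fin.prod_univ_two, div_eq_inv_mul])
  simpa using congrFun this 0

/-- **Janiszewski's theorem**. -/
theorem joinedIn_compl_union {A B : Set ℂ} (hA : IsCompact A) (hB : IsCompact B)
    (hAB : IsPreconnected (A ∩ B)) {p q : ℂ} (hpA : JoinedIn Aᶜ p q) (hpB : JoinedIn Bᶜ p q) :
    JoinedIn (A ∪ B)ᶜ p q :=
  joinedIn_compl_of_hasLogOn (hA.union hB) (fun h => h.elim hpA.source_mem hpB.source_mem)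
    (fun h => h.elim hpA.target_mem hpB.target_mem) <|
    (hasLogOn_div_of_joinedIn hpA).union (hasLogOn_div_of_joinedIn hpB) hAB
      fun _ hkA hkB => hkA.union_of_isClosed hkB hA.isClosed hB.isClosed

-- If all three points were separated by `A ∪ B`, Eilenberg's criterion would forbid the logarithm
-- of `((z - p 0) / (z - p 1)) ^ m * ((z - p 0) / (z - p 2)) ^ n` on `A ∪ B`.
theorem exists_joinedIn_compl_union_of_inter_eq_pair {A B : Set ℂ} (hA : IsCompact A)
    (hB : IsCompact B) {x y : ℂ} (hAB : A ∩ B = {x, y}) {p : Fin 3 → ℂ}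
    (hpA : ∀ i j, JoinedIn Aᶜ (p i) (p j)) (hpB : ∀ i j, JoinedIn Bᶜ (p i) (p j)) :
    ∃ i j, i ≠ j ∧ JoinedIn (A ∪ B)ᶜ (p i) (p j) := by
  have hp : ∀ i, p i ∈ (A ∪ B)ᶜ := fun i =>
    compl_union A B ▸ ⟨(hpA i i).source_mem, (hpB i i).source_mem⟩
  obtain ⟨m, n, hmn, hlog⟩ := exists_hasLogOn_union_zpow_mul_zpow
    (hasLogOn_div_of_joinedIn (hpA 1 0)) (hasLogOn_div_of_joinedIn (hpB 1 0))
    (hasLogOn_div_of_joinedIn (hpA 2 0)) (hasLogOn_div_of_joinedIn (hpB 2 0)) hAB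
    fun k hkA hkB => hkA.union_of_isClosed hkB hA.isClosed hB.isClosed
  by_contra! hsep
  have hinj : Function.Injective fun i => connectedComponentIn (A ∪ B)ᶜ (p i) := fun i j hij =>
    by_contra fun hne => hsep i j hne <|
      joinedIn_of_connectedComponentIn_eq (hA.union hB).isClosed.isOpen_compl (hp i) (hp j) hij
  have hzero := eq_zero_of_hasLogOn_prod_zpow (hA.union hB) hp hinj (n := ![m + n, -m, -n])
    (by simp [Fin.sum_univ_three]) <| hlog.congr fun z hz => by
      have hz0 : z - p 0 ≠ 0 := fun h => hp 0 (sub_eq_zero.1 h ▸ hz)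
      simp only [div_zpow, Fin.prod_univ_three, Matrix.cons_val_zero, zpow_add₀ hz0,
        Matrix.cons_val_one, zpow_neg, Matrix.cons_val]
      field_simp
  have hm : -m = 0 := congrFun hzero 1
  have hn : -n = 0 := congrFun hzero 2
  omega

/-! ### Arcs -/

theorem joinedIn_image_Icc {X : Type*} [TopologicalSpace X] {γ : I → X} (hγ : Continuous γ)
    {s t : I} (hst : s ≤ t) : JoinedIn (γ '' Icc s t) (γ s) (γ t) :=
  ⟨⟨⟨fun u => γ (projIcc s t hst u), by fun_prop⟩,
    congrArg γ (congrArg Subtype.val (projIcc_of_le_left hst (unitInterval.nonneg' : 0 ≤ s))),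
    congrArg γ (congrArg Subtype.val (projIcc_of_right_le hst (unitInterval.le_one' : t ≤ 1)))⟩,
    fun u => mem_image_of_mem γ (projIcc s t hst u).2⟩

theorem joinedIn_compl_image_Icc {γ : I → ℂ} (hγ : Continuous γ) {s t : I}
    (hinj : InjOn γ (Icc s t)) {p q : ℂ} (hp : p ∉ γ '' Icc s t) (hq : q ∉ γ '' Icc s t) :
    JoinedIn (γ '' Icc s t)ᶜ p q := by
  have hne : ∀ z ∈ γ '' Icc s t, z - p ≠ 0 := fun z hz h => hp (sub_eq_zero.1 h ▸ hz)
  refine joinedIn_compl_of_hasLogOn (isCompact_Icc.image hγ) hp hq <|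
    hasLogOn_image_Icc hγ hinj (ContinuousOn.div (by fun_prop) (by fun_prop) hne) fun z hz =>
      div_ne_zero (fun h => hq (sub_eq_zero.1 h ▸ hz)) (hne z hz)

-- The sets `Aᶜ` and `Bᶜ` carry logarithms of `(z - b) / (z - a)`. If their intersection `(A ∪ B)ᶜ`
-- were connected, these would glue to a logarithm off `{a, b}`, although `(z - b) / (z - a)` winds
-- around `a`.
theorem not_isPreconnected_compl_union {A B : Set ℂ} {a b : ℂ} (hA : IsClosed A) (hB : IsClosed B)
    (hab : a ≠ b) (hAab : JoinedIn A a b) (hBab : JoinedIn B a b) (hAB : A ∩ B = {a, b}) :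
    ¬ IsPreconnected (A ∪ B)ᶜ := by
  intro hpre
  have hlog : HasLogOn (fun z => (z - b) / (z - a)) ({a, b} : Set ℂ)ᶜ := by
    rw [← hAB, compl_inter]
    rw [compl_union] at hpre
    exact (hasLogOn_div_of_joinedIn ((compl_compl A).symm ▸ hAab)).union
      (hasLogOn_div_of_joinedIn ((compl_compl B).symm ▸ hBab)) hpre
      fun k hkA hkB => hkA.union_of_isOpen hkB hA.isOpen_compl hB.isOpen_compl
  obtain ⟨r, hr, hrb⟩ : ∃ r, 0 < r ∧ r < dist b a := exists_between (dist_pos.2 hab.symm)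
  have hne : ∀ z ∈ Metric.closedBall a r, z - b ≠ 0 := fun z hz h =>
    hrb.not_ge (sub_eq_zero.1 h ▸ Metric.mem_closedBall.1 hz)
  have hcl : closure (Metric.ball a r) ⊆ Metric.closedBall a r :=
    Metric.closure_ball_subset_closedBall
  have := eq_zero_of_hasLogOn_zpow_mul (n := -1) (f := fun z => z - b) Metric.isClosed_sphere
    Metric.isOpen_ball Metric.isBounded_ball (frontier_ball a hr.ne').subset
    (Metric.mem_ball_self hr) (by fun_prop) (fun z hz => hne z (hcl hz))
    ((hlog.mono fun z hz => ?_).congr fun z _ => by simp [div_eq_inv_mul])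
  · simp at this
  · rintro (rfl | rfl)
    · simp [hr.ne] at hz
    · exact hne z (Metric.sphere_subset_closedBall hz) (sub_self z)

theorem joinedIn_compl_union_image_Icc {A : Set ℂ} (hA : IsCompact A) {γ : I → ℂ}
    (hγ : Continuous γ) {s t : I} (hinj : InjOn γ (Icc s t)) (hAγ : (A ∩ γ '' Icc s t).Subsingleton)
    {p q : ℂ} (h : JoinedIn Aᶜ p q) (hp : p ∉ γ '' Icc s t) (hq : q ∉ γ '' Icc s t) :
    JoinedIn (A ∪ γ '' Icc s t)ᶜ p q :=
  joinedIn_compl_union hA (isCompact_Icc.image hγ) hAγ.isPreconnected h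
    (joinedIn_compl_image_Icc hγ hinj hp hq)

/-- A path without self-crossings, except that it may be closed. -/
structure IsSimpleCurve {X : Type*} [TopologicalSpace X] (γ : I → X) : Prop where
  continuous : Continuous γ
  eq_of_apply_eq : ∀ s ∈ Ioo (0 : I) 1, ∀ t, γ s = γ t → s = t

namespace IsSimpleCurve

theorem injOn_Icc {X : Type*} [TopologicalSpace X] {γ : I → X} (hγ : IsSimpleCurve γ) {s t : I}
    (h : 0 < s ∨ t < 1 ∨ γ 0 ≠ γ 1) : InjOn γ (Icc s t) := by
  intro u hu v hv huv
  by_contra hne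
  wlog hlt : u < v generalizing u v
  · exact this hv hu huv.symm (Ne.symm hne) (lt_of_le_of_ne (not_lt.1 hlt) (Ne.symm hne))
  have hu0 : u = 0 := by_contra fun h0 => hne <| hγ.eq_of_apply_eq u
    ⟨lt_of_le_of_ne unitInterval.nonneg' (Ne.symm h0), hlt.trans_le unitInterval.le_one'⟩ v huv
  have hv1 : v = 1 := by_contra fun h1 => hne <| Eq.symm <| hγ.eq_of_apply_eq v
    ⟨unitInterval.nonneg'.trans_lt hlt, lt_of_le_of_ne unitInterval.le_one' h1⟩ u huv.symm
  subst hu0 hv1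
  exact h.elim hu.1.not_gt fun h => h.elim hv.2.not_gt fun h => h huv

-- A small circle around an interior point `γ u` would be covered by the images of `[0, u]` and
-- `[u, 1]`, which both meet it but share no point of it.
theorem interior_range_eq_empty {γ : I → ℂ} (hγ : IsSimpleCurve γ) : interior (range γ) = ∅ := by
  by_contra hne
  have hdense := ((countable_singleton (γ 1)).insert (γ 0)).dense_compl ℝ
  obtain ⟨p, hp, hpγ⟩ :=
    hdense.inter_open_nonempty _ isOpen_interior (nonempty_iff_ne_empty.2 hne)
  obtain ⟨u, rfl⟩ := interior_subset hp
  simp only [mem_compl_iff, mem_insert_iff, mem_singleton_iff, not_or] at hpγ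
  obtain ⟨ε, hε, hball⟩ := Metric.isOpen_iff.1 isOpen_interior _ hp
  obtain ⟨r, hr, hlt⟩ := exists_between
    (lt_min hε (lt_min (dist_pos.2 (Ne.symm hpγ.1)) (dist_pos.2 (Ne.symm hpγ.2))))
  obtain ⟨hrε, hr0, hr1⟩ := by simpa only [lt_min_iff] using hlt
  have hcont : Continuous fun t => dist (γ t) (γ u) := hγ.continuous.dist continuous_const
  obtain ⟨s₀, hs₀, hd₀⟩ := intermediate_value_Icc' (unitInterval.nonneg' : 0 ≤ u) hcont.continuousOn
    ⟨(dist_self (γ u)).symm ▸ hr.le, hr0.le⟩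
  obtain ⟨s₁, hs₁, hd₁⟩ := intermediate_value_Icc (unitInterval.le_one' : u ≤ 1) hcont.continuousOn
    ⟨(dist_self (γ u)).symm ▸ hr.le, hr1.le⟩
  have hcover : Metric.sphere (γ u) r ⊆ γ '' Iic u ∪ γ '' Ici u := by
    rw [← image_union, Iic_union_Ici, image_univ]
    exact fun z hz => interior_subset (hball ((Metric.mem_sphere.1 hz).trans_lt hrε))
  obtain ⟨z, hz, ⟨t, ht, rfl⟩, ⟨t', ht', htt'⟩⟩ := isPreconnected_closed_iff.1
    (isPreconnected_sphere (by simp) (γ u) r) _ _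
    (isClosed_Iic.isCompact.image hγ.continuous).isClosed
    (isClosed_Ici.isCompact.image hγ.continuous).isClosed hcover
    ⟨γ s₀, hd₀, s₀, hs₀.2, rfl⟩ ⟨γ s₁, hd₁, s₁, hs₁.1, rfl⟩
  have ht0 : 0 < t := lt_of_le_of_ne unitInterval.nonneg' <| by
    rintro rfl
    exact hr0.ne' hz
  have ht1 : t < 1 := lt_of_le_of_ne unitInterval.le_one' <| by
    rintro rfl
    exact hr1.ne' hz
  obtain rfl := hγ.eq_of_apply_eq t ⟨ht0, ht1⟩ t' htt'.symm
  obtain rfl : t = u := le_antisymm ht ht'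
  exact hr.ne (by simpa using hz)

end IsSimpleCurve

end PlaneTopology

namespace Graph.Reachable

open Set

variable {α β : Type*} {G H : Graph α β} {x y z : α} {e : β}

theorem refl (hx : x ∈ V(G)) : G.Reachable x x := ⟨hx, .refl⟩

theorem trans (h : G.Reachable x y) (h' : G.Reachable y z) : G.Reachable x z :=
  ⟨h.1, h.2.trans h'.2⟩

theorem of_isLink (h : G.IsLink e x y) : G.Reachable x y := ⟨h.left_mem, .single h.adj⟩

theorem symm (h : G.Reachable x y) : G.Reachable y x := by
  obtain ⟨hx, h⟩ := h
  induction h with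
  | refl => exact refl hx
  | tail _ hadj ih => exact trans ⟨hadj.right_mem, .single hadj.symm⟩ ih

theorem right_mem (h : G.Reachable x y) : y ∈ V(G) := h.symm.1

theorem mono (hGH : G ≤ H) (h : G.Reachable x y) : H.Reachable x y :=
  ⟨hGH.vertexSet_mono h.1,
    Relation.ReflTransGen.mono (fun _ _ ⟨e, he⟩ => ⟨e, hGH.isLink_mono he⟩) _ _ h.2⟩

end Graph.Reachable

section

open Set

variable {α β : Type*} {G H : Graph α β} {x y z : α} {e : β}

theorem Graph.Reachable.exists_isLink_of_mem_of_notMem {A : Set α} (h : G.Reachable x y)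
    (hx : x ∈ A) (hy : y ∉ A) : ∃ e u v, G.IsLink e u v ∧ u ∈ A ∧ v ∉ A := by
  obtain ⟨-, h⟩ := h
  induction h with
  | refl => exact absurd hx hy
  | @tail u v _ hadj ih =>
    by_cases hu : u ∈ A
    · obtain ⟨e, he⟩ := hadj
      exact ⟨e, u, v, he, hu, hy⟩
    · exact ih hu

theorem Graph.IsConnected.mono (hGH : G ≤ H) (hV : V(G) = V(H)) (h : G.IsConnected) :
    H.IsConnected :=
  ⟨hV ▸ h.1, fun x hx y hy => (h.2 x (hV ▸ hx) y (hV ▸ hy)).mono hGH⟩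

theorem Graph.IsCycle.reachable_deleteEdges {n : ℕ} {v : ℕ → α} {f : ℕ → β} (h : G.IsCycle n v f) :
    (G.deleteEdges {f 0}).Reachable (v 1) (v 0) := by
  suffices ∀ k, 1 ≤ k → k ≤ n → (G.deleteEdges {f 0}).Reachable (v 1) (v k) from
    h.closed ▸ this n h.pos le_rfl
  intro k hk
  induction k, hk using Nat.le_induction with
  | base => exact fun _ => .refl (h.isLink 0 h.pos).right_mem
  | succ k hk ih =>
    refine fun hkn => (ih (Nat.le_of_succ_le hkn)).trans (.of_isLink ⟨h.isLink k hkn, fun h0 => ?_⟩)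
    exact Nat.one_le_iff_ne_zero.1 hk (h.edge_injOn hkn h.pos h0)

theorem Graph.IsConnected.isTree (h : G.IsConnected)
    (hbridge : ∀ e x y, G.IsLink e x y → ¬ (G.deleteEdges {e}).Reachable x y) : G.IsTree :=
  ⟨h, fun _ _ _ hc => hbridge _ _ _ (hc.isLink 0 hc.pos) hc.reachable_deleteEdges.symm⟩

end

/-- The distance of `x` and `y` in `G`. As for `SimpleGraph.dist`, it is `0` if `x` and `y` lie in
different components. -/
noncomputable def graphDist {α β : Type*} (G : Graph α β) (x y : α) : ℕ :=
  (SimpleGraph.fromRel G.Adj).dist x y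

namespace graphDist

open Set SimpleGraph

variable {α β : Type*} {G : Graph α β} {x y z : α} {e : β} {n : ℕ}

theorem reachable_fromRel (h : G.Reachable x y) : (SimpleGraph.fromRel G.Adj).Reachable x y := by
  obtain ⟨-, h⟩ := h
  induction h with
  | refl => exact .refl x
  | @tail u v _ hadj ih =>
    rcases eq_or_ne u v with rfl | hne
    · exact ih
    · exact ih.trans (SimpleGraph.Adj.reachable ⟨hne, .inl hadj⟩)

theorem adj_of_fromRel_adj (h : (SimpleGraph.fromRel G.Adj).Adj x y) : G.Adj x y :=
  h.2.elim id Graph.Adj.symm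

theorem le_of_hasPathWithFirstEdge (h : G.HasPathWithFirstEdge x y e n) : graphDist G x y ≤ n := by
  obtain ⟨v, f, -, rfl, rfl, -, hinj, hf⟩ := h
  suffices ∀ k ≤ n, ∃ p : (SimpleGraph.fromRel G.Adj).Walk (v 0) (v k), p.length = k by
    obtain ⟨p, hp⟩ := this n le_rfl
    exact (dist_le p).trans_eq hp
  intro k hk
  induction k with
  | zero => exact ⟨.nil, rfl⟩
  | succ k ih =>
    obtain ⟨p, hp⟩ := ih (Nat.le_of_succ_le hk)
    have hne : v k ≠ v (k + 1) :=
      hinj.ne (mem_Iic.2 (Nat.le_of_succ_le hk)) (mem_Iic.2 hk) (Nat.succ_ne_self k).symm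
    have hadj : (SimpleGraph.fromRel G.Adj).Adj (v k) (v (k + 1)) := ⟨hne, .inl (hf k hk).adj⟩
    exact ⟨p.concat hadj, by rw [Walk.length_concat, hp]⟩

theorem exists_hasPathWithFirstEdge (h : G.Reachable x y) (hne : x ≠ y) :
    ∃ e, G.HasPathWithFirstEdge x y e (graphDist G x y) := by
  obtain ⟨p, hp, hlen⟩ := (reachable_fromRel h).exists_path_of_dist
  have hlink : ∀ k < p.length, ∃ e, G.IsLink e (p.getVert k) (p.getVert (k + 1)) := fun k hk =>
    adj_of_fromRel_adj (p.adj_getVert_succ hk)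
  have hpos : 0 < p.length := hlen ▸ (reachable_fromRel h).pos_dist_of_ne hne
  have : Nonempty β := ⟨(hlink 0 hpos).choose⟩
  choose! f hf using hlink
  rw [graphDist, ← hlen]
  exact ⟨f 0, p.getVert, f, hpos, p.getVert_zero, p.getVert_length, rfl, hp.getVert_injOn, hf⟩

theorem exists_isLink_add_one_eq (h : G.Reachable y x) (hne : x ≠ y) :
    ∃ e z, G.IsLink e x z ∧ graphDist G y z + 1 = graphDist G y x := by
  obtain ⟨p, hp⟩ := (reachable_fromRel h.symm).exists_walk_length_eq_dist
  cases p with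
  | nil => exact absurd rfl hne
  | @cons _ z _ hadj q =>
    obtain ⟨e, he⟩ := adj_of_fromRel_adj hadj
    obtain ⟨q', hq'⟩ := q.reachable.exists_walk_length_eq_dist
    refine ⟨e, z, he, ?_⟩
    have h₁ := dist_le q
    have h₂ := dist_le (Walk.cons hadj q')
    rw [Walk.length_cons] at hp h₂
    rw [graphDist, graphDist, dist_comm, dist_comm (u := y) (v := x)]
    lia

end graphDist

/-- A shortest-path tree of `H` rooted at `r`: every other vertex `x` has a parent, joined to it by
the edge `parentEdge x` and closer to the root by one. The root is its own parent. -/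
structure SearchTree {α β : Type*} (H : Graph α β) (r : α) where
  /-- The next vertex on the way to the root. -/
  parent : α → α
  /-- The edge towards the parent. -/
  parentEdge : α → β
  parent_root : parent r = r
  isLink : ∀ x ∈ V(H), x ≠ r → H.IsLink (parentEdge x) x (parent x)
  graphDist_parent : ∀ x ∈ V(H), x ≠ r → graphDist H r (parent x) + 1 = graphDist H r x

namespace SearchTree

open Set

variable {α β : Type*} {H : Graph α β} {r x y : α}

theorem nonempty [Nonempty β] (hH : H.IsConnected) (hr : r ∈ V(H)) : Nonempty (SearchTree H r) := by
  have hstep : ∀ x ∈ V(H), x ≠ r → ∃ e z, H.IsLink e x z ∧ graphDist H r z + 1 = graphDist H r x :=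
    fun x hx hne => graphDist.exists_isLink_add_one_eq (hH.2 r hr x hx) hne
  have : Nonempty α := ⟨r⟩
  choose! e p he hp using hstep
  classical
  exact ⟨{
    parent := Function.update p r r
    parentEdge := e
    parent_root := Function.update_self ..
    isLink := fun x hx hne => by rw [Function.update_of_ne hne]; exact he x hx hne
    graphDist_parent := fun x hx hne => by rw [Function.update_of_ne hne]; exact hp x hx hne }⟩

variable (T : SearchTree H r)

/-- The edge set of the tree. -/
def edges : Set β := T.parentEdge '' (V(H) \ {r})

/-- The vertices on the way from `y` to the root, with `y` included and the root excluded. They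
stand for the edges on this way, each of them being the parent edge of its upper end. -/
def ancestors (y : α) : Set α := {x | x ≠ r ∧ ∃ k, T.parent^[k] y = x}

theorem induction_on {P : α → Prop} (root : P r)
    (step : ∀ x ∈ V(H), x ≠ r → P (T.parent x) → P x) (x : α) (hx : x ∈ V(H)) : P x := by
  induction hn : graphDist H r x generalizing x with
  | zero =>
    by_contra hP
    have hne : x ≠ r := by rintro rfl; exact hP root
    exact (Nat.succ_ne_zero _) ((T.graphDist_parent x hx hne).trans hn)
  | succ n ih =>
    rcases eq_or_ne x r with rfl | hne
    · exact root
    · exact step x hx hne (ih _ (T.isLink x hx hne).right_mem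
        (Nat.succ_injective ((T.graphDist_parent x hx hne).trans hn)))

variable {T}

theorem isConnected_restrict_edges (hr : r ∈ V(H)) : (H.restrict T.edges).IsConnected := by
  have hroot : ∀ x ∈ V(H), (H.restrict T.edges).Reachable x r :=
    T.induction_on (.refl hr) fun x hx hne h =>
      .trans (.of_isLink ⟨mem_image_of_mem _ ⟨hx, hne⟩, T.isLink x hx hne⟩) h
  exact ⟨⟨r, hr⟩, fun x hx y hy => (hroot x hx).trans (hroot y hy).symm⟩

theorem ancestors_root : T.ancestors r = ∅ :=
  eq_empty_of_forall_notMem fun _ ⟨hne, k, hk⟩ =>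
    hne (hk.symm.trans (Function.iterate_fixed T.parent_root k))

theorem ancestors_of_ne (hy : y ≠ r) : T.ancestors y = insert y (T.ancestors (T.parent y)) := by
  ext x
  constructor
  · rintro ⟨hne, k | k, hk⟩
    exacts [.inl hk.symm, .inr ⟨hne, k, hk⟩]
  · rintro (rfl | ⟨hne, k, hk⟩)
    exacts [⟨hy, 0, rfl⟩, ⟨hne, k + 1, hk⟩]

theorem encard_ancestors_le (hy : y ∈ V(H)) : (T.ancestors y).encard ≤ graphDist H r y := by
  refine T.induction_on (P := fun y => (T.ancestors y).encard ≤ graphDist H r y) ?_ ?_ y hy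
  · simp only [ancestors_root, encard_empty, zero_le]
  · intro x hx hne ih
    rw [ancestors_of_ne hne, ← T.graphDist_parent x hx hne, Nat.cast_add, Nat.cast_one]
    exact (encard_insert_le _ _).trans (by gcongr)

theorem exists_isLink_ancestors {S : Set β} (hS : (H.restrict S).IsConnected) (hr : r ∈ V(H))
    (hx : x ∈ V(H)) (hxr : x ≠ r) : ∃ e ∈ S, ∃ y z, H.IsLink e y z ∧ x ∈ T.ancestors y ∧
      x ∉ T.ancestors z ∧ (e ∈ T.edges → e = T.parentEdge x) := by
  obtain ⟨e, y, z, ⟨heS, he⟩, hy, hz⟩ := (hS.2 x hx r hr).exists_isLink_of_mem_of_notMem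
    (A := {y | x ∈ T.ancestors y}) ⟨hxr, 0, rfl⟩ (fun h => notMem_empty x (T.ancestors_root ▸ h))
  refine ⟨e, heS, y, z, he, hy, hz, ?_⟩
  rintro ⟨w, ⟨hw, hwr⟩, rfl⟩
  rw [mem_ofPred_eq] at hy hz
  rcases he.eq_and_eq_or_eq_and_eq (T.isLink w hw hwr) with ⟨rfl, rfl⟩ | ⟨rfl, rfl⟩
  · rw [ancestors_of_ne hwr] at hy
    rw [hy.resolve_right hz]
  · rw [ancestors_of_ne hwr] at hz
    exact absurd (mem_insert_of_mem z hy) hz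

end SearchTree

namespace Graph.PlaneDrawing

open Set PlaneTopology

variable {α β : Type*} {G : Graph α β} {D : PlaneDrawing G} {e g : β} {S T : Set β}
  {F F' O O' : Set ℂ} {s t : I} {z : ℂ} {a b v w x y : α}

/-! ### Partial drawings -/

variable (D S) in
/-- The part of the drawing that consists of all vertices and the edges in `S`. -/
def supportOn : Set ℂ := D.point '' V(G) ∪ ⋃ e ∈ E(G) ∩ S, range (D.curve e)

theorem supportOn_univ : D.supportOn univ = D.support := by
  rw [supportOn, inter_univ, support]

theorem supportOn_mono (h : S ⊆ T) : D.supportOn S ⊆ D.supportOn T :=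
  union_subset_union_right _ (biUnion_subset_biUnion_left (inter_subset_inter_right _ h))

theorem supportOn_subset_support : D.supportOn S ⊆ D.support :=
  supportOn_univ (D := D) ▸ supportOn_mono (subset_univ S)

theorem supportOn_insert (he : e ∈ E(G)) :
    D.supportOn (insert e S) = D.supportOn S ∪ range (D.curve e) := by
  rw [supportOn, inter_insert_of_mem he, biUnion_insert, supportOn, union_assoc,
    union_comm (range _)]

theorem supportOn_compl_singleton_union (he : e ∈ E(G)) :
    D.supportOn {e}ᶜ ∪ range (D.curve e) = D.support := by
  rw [← supportOn_insert he, insert_eq, union_compl_self, supportOn_univ]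

theorem isCompact_supportOn (hV : V(G).Finite) (hE : E(G).Finite) : IsCompact (D.supportOn S) :=
  (hV.image _).isCompact.union <| (hE.inter_of_left S).isCompact_biUnion fun e he =>
    isCompact_range (D.curve_continuous e he.1)

theorem isCompact_support (hV : V(G).Finite) (hE : E(G).Finite) : IsCompact D.support :=
  supportOn_univ (D := D) ▸ isCompact_supportOn hV hE

theorem isOpen_compl_supportOn (hV : V(G).Finite) (hE : E(G).Finite) :
    IsOpen (D.supportOn S)ᶜ :=
  (isCompact_supportOn hV hE).isClosed.isOpen_compl

theorem point_mem_supportOn {v : α} (hv : v ∈ V(G)) : D.point v ∈ D.supportOn S :=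
  Or.inl ⟨v, hv, rfl⟩

theorem curve_mem_supportOn (he : e ∈ E(G)) (heS : e ∈ S) : D.curve e t ∈ D.supportOn S :=
  Or.inr (mem_biUnion ⟨he, heS⟩ ⟨t, rfl⟩)

theorem curve_notMem_image_point (he : e ∈ E(G)) (ht : t ∈ Ioo 0 1) :
    D.curve e t ∉ D.point '' V(G) := fun ⟨v, hv, h⟩ => D.curve_ne_point e he t ht v hv h.symm

theorem exists_inc_point_eq_curve (he : e ∈ E(G)) (ht : t ∉ Ioo 0 1) :
    ∃ x, G.Inc e x ∧ D.point x = D.curve e t := by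
  obtain ⟨x, y, hxy, h0, h1⟩ := D.curve_ends e he
  rcases (unitInterval.nonneg' : 0 ≤ t).eq_or_lt with rfl | ht0
  · exact ⟨x, hxy.inc_left, h0.symm⟩
  · obtain rfl : t = 1 := by_contra fun h =>
      ht ⟨ht0, lt_of_le_of_ne unitInterval.le_one' h⟩
    exact ⟨y, hxy.inc_right, h1.symm⟩

theorem curve_end_mem_image_point (he : e ∈ E(G)) (ht : t ∉ Ioo 0 1) :
    D.curve e t ∈ D.point '' V(G) :=
  let ⟨x, hx, hxt⟩ := exists_inc_point_eq_curve he ht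
  ⟨x, hx.vertex_mem, hxt⟩

theorem mem_Ioo_of_curve_notMem_supportOn (he : e ∈ E(G)) (h : D.curve e t ∉ D.supportOn S) :
    t ∈ Ioo 0 1 :=
  by_contra fun ht => h (Or.inl (curve_end_mem_image_point he ht))

theorem eq_of_curve_eq_curve {e' : β} (he : e ∈ E(G)) (he' : e' ∈ E(G)) (hs : s ∈ Ioo 0 1)
    (h : D.curve e s = D.curve e' t) : e = e' := by
  by_contra hne
  by_cases ht : t ∈ Ioo 0 1
  · exact disjoint_left.1 (D.curve_disjoint e he e' he' hne) ⟨s, hs, rfl⟩ ⟨t, ht, h.symm⟩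
  · exact curve_notMem_image_point he hs (h ▸ curve_end_mem_image_point he' ht)

theorem curve_notMem_supportOn (he : e ∈ E(G)) (heS : e ∉ S) (ht : t ∈ Ioo 0 1) :
    D.curve e t ∉ D.supportOn S := by
  rintro (h | h)
  · exact curve_notMem_image_point he ht h
  · obtain ⟨e', ⟨he', he'S⟩, u, hu⟩ := mem_iUnion₂.1 h
    exact heS (eq_of_curve_eq_curve he he' ht hu.symm ▸ he'S)

variable (D) in
theorem isSimpleCurve_curve (he : e ∈ E(G)) : IsSimpleCurve (D.curve e) where
  continuous := D.curve_continuous e he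
  eq_of_apply_eq _ hs _ h := D.curve_injOn e he hs
    (by_contra fun ht => curve_notMem_image_point he hs (h ▸ curve_end_mem_image_point he ht)) h

theorem subsingleton_supportOn_inter_image_Icc (he : e ∈ E(G)) (heS : e ∉ S)
    (hst : 0 < s ∨ t < 1) : (D.supportOn S ∩ D.curve e '' Icc s t).Subsingleton := by
  rintro _ ⟨hu, u, hust, rfl⟩ _ ⟨hv, v, hvst, rfl⟩
  have hend : ∀ w ∈ Icc s t, D.curve e w ∈ D.supportOn S → w = if 0 < s then 1 else 0 := by
    intro w hw hwS
    split_ifs with hs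
    · exact by_contra fun h1 => curve_notMem_supportOn he heS
        ⟨hs.trans_le hw.1, lt_of_le_of_ne unitInterval.le_one' h1⟩ hwS
    · exact by_contra fun h0 => curve_notMem_supportOn he heS
        ⟨lt_of_le_of_ne unitInterval.nonneg' (Ne.symm h0), hw.2.trans_lt (hst.resolve_left hs)⟩ hwS
  rw [hend u hust hu, hend v hvst hv]

theorem interior_support (hV : V(G).Finite) (hE : E(G).Finite) : interior D.support = ∅ := by
  suffices h : ∀ S : Set β, S.Finite → S ⊆ E(G) → interior (D.supportOn S) = ∅ by
    have := h E(G) hE Subset.rfl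
    rwa [supportOn, inter_self] at this
  intro S hS hSE
  induction S, hS using Set.Finite.induction_on with
  | empty =>
    rw [supportOn, inter_empty, biUnion_empty, union_empty]
    exact interior_eq_empty_iff_dense_compl.2 ((hV.image _).countable.dense_compl ℝ)
  | @insert e S _ _ ih =>
    obtain ⟨he, hSE⟩ := insert_subset_iff.1 hSE
    rw [supportOn_insert he, interior_union_isClosed_of_interior_empty
      (isCompact_supportOn hV hE).isClosed (isSimpleCurve_curve D he).interior_range_eq_empty,
      ih hSE]

theorem dense_compl_support (hV : V(G).Finite) (hE : E(G).Finite) : Dense D.supportᶜ :=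
  interior_eq_empty_iff_dense_compl.1 (interior_support hV hE)

/-! ### Faces and edges -/

theorem isFace_connectedComponentIn (hz : z ∉ D.support) :
    D.IsFace (connectedComponentIn D.supportᶜ z) := ⟨z, hz, rfl⟩

namespace IsFace

theorem eq_connectedComponentIn (hF : D.IsFace F) (hz : z ∈ F) :
    F = connectedComponentIn D.supportᶜ z := by
  obtain ⟨w, -, rfl⟩ := hF
  exact connectedComponentIn_eq hz

theorem subset (hF : D.IsFace F) : F ⊆ D.supportᶜ := by
  obtain ⟨w, -, rfl⟩ := hF
  exact connectedComponentIn_subset _ _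

theorem nonempty (hF : D.IsFace F) : F.Nonempty := by
  obtain ⟨w, hw, rfl⟩ := hF
  exact ⟨w, mem_connectedComponentIn hw⟩

theorem isPreconnected (hF : D.IsFace F) : IsPreconnected F := by
  obtain ⟨w, -, rfl⟩ := hF
  exact isPreconnected_connectedComponentIn

theorem isOpen (hV : V(G).Finite) (hE : E(G).Finite) (hF : D.IsFace F) : IsOpen F := by
  obtain ⟨w, -, rfl⟩ := hF
  exact (isCompact_support hV hE).isClosed.isOpen_compl.connectedComponentIn

theorem frontier_subset (hV : V(G).Finite) (hE : E(G).Finite) (hF : D.IsFace F) :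
    frontier F ⊆ D.support := by
  obtain ⟨w, -, rfl⟩ := hF
  exact frontier_connectedComponentIn_compl_subset (isCompact_support hV hE).isClosed w

theorem eq_of_joinedIn (hV : V(G).Finite) (hE : E(G).Finite) (hF : D.IsFace F)
    (hF' : D.IsFace F') {p q : ℂ} (hp : p ∈ F) (hq : q ∈ F') (h : JoinedIn D.supportᶜ p q) :
    F = F' := by
  rw [hF.eq_connectedComponentIn hp, hF'.eq_connectedComponentIn hq]
  exact connectedComponentIn_eq <| (joinedIn_iff_mem_connectedComponentIn
    (isCompact_support hV hE).isClosed.isOpen_compl (hF.subset hp)).1 h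

end IsFace

variable (D e) in
/-- The component, in the complement of the drawing without the edge `e`, of the interior of `e`. -/
def edgeRegion : Set ℂ :=
  ⋃ t ∈ Ioo (0 : I) 1, connectedComponentIn (D.supportOn {e}ᶜ)ᶜ (D.curve e t)

theorem edgeRegion_eq (he : e ∈ E(G)) (ht : t ∈ Ioo 0 1) :
    D.edgeRegion e = connectedComponentIn (D.supportOn {e}ᶜ)ᶜ (D.curve e t) := by
  have heq : ∀ s ∈ Ioo (0 : I) 1, connectedComponentIn (D.supportOn {e}ᶜ)ᶜ (D.curve e s) =
      connectedComponentIn (D.supportOn {e}ᶜ)ᶜ (D.curve e t) := fun s hs =>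
    connectedComponentIn_eq <|
      IsPreconnected.subset_connectedComponentIn
        (isPreconnected_Ioo.image _ (D.curve_continuous e he).continuousOn)
        (mem_image_of_mem _ hs)
        (by rintro _ ⟨u, hu, rfl⟩; exact curve_notMem_supportOn he (not_not.2 rfl) hu)
        (mem_image_of_mem _ ht)
  rw [edgeRegion, iUnion₂_congr heq, biUnion_const ⟨t, ht⟩]

theorem curve_mem_edgeRegion (he : e ∈ E(G)) (ht : t ∈ Ioo 0 1) :
    D.curve e t ∈ D.edgeRegion e := by
  rw [edgeRegion_eq he ht]
  exact mem_connectedComponentIn (curve_notMem_supportOn he (not_not.2 rfl) ht)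

theorem isOpen_edgeRegion (hV : V(G).Finite) (hE : E(G).Finite) : IsOpen (D.edgeRegion e) :=
  isOpen_biUnion fun _ _ => (isOpen_compl_supportOn hV hE).connectedComponentIn

theorem edgeRegion_subset : D.edgeRegion e ⊆ (D.supportOn {e}ᶜ)ᶜ :=
  iUnion₂_subset fun _ _ => connectedComponentIn_subset _ _

theorem exists_mem_Ioo : ∃ t : I, t ∈ Ioo 0 1 := exists_between zero_lt_one

theorem isPreconnected_edgeRegion (he : e ∈ E(G)) : IsPreconnected (D.edgeRegion e) := by
  obtain ⟨t, ht⟩ := exists_mem_Ioo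
  exact edgeRegion_eq he ht ▸ isPreconnected_connectedComponentIn

theorem joinedIn_of_mem_edgeRegion (hV : V(G).Finite) (hE : E(G).Finite) (he : e ∈ E(G)) {p q : ℂ}
    (hp : p ∈ D.edgeRegion e) (hq : q ∈ D.edgeRegion e) : JoinedIn (D.supportOn {e}ᶜ)ᶜ p q :=
  ((isPreconnected_iff_forall_joinedIn (isOpen_edgeRegion hV hE)).1
    (isPreconnected_edgeRegion he) p hp q hq).mono edgeRegion_subset

theorem IsBoundaryEdge.subset_edgeRegion (hV : V(G).Finite) (hE : E(G).Finite)
    (h : D.IsBoundaryEdge e F) (hF : D.IsFace F) : F ⊆ D.edgeRegion e := by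
  obtain ⟨t, ht⟩ := exists_mem_Ioo
  obtain ⟨y, hy, hyF⟩ := mem_closure_iff.1 (frontier_subset_closure (h.2 ⟨t, rfl⟩)) _
    (isOpen_edgeRegion hV hE) (curve_mem_edgeRegion h.1 ht)
  rw [edgeRegion_eq h.1 ht] at hy ⊢
  rw [connectedComponentIn_eq hy]
  exact hF.isPreconnected.subset_connectedComponentIn hyF
    (hF.subset.trans (compl_subset_compl.2 supportOn_subset_support))

theorem joinedIn_compl_supportOn_union_ends (hV : V(G).Finite) (hE : E(G).Finite) (he : e ∈ E(G))
    (heS : e ∉ S) (hst : s < t) {p q : ℂ} (h : JoinedIn (D.supportOn S)ᶜ p q)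
    (hp : p ∉ D.curve e '' Icc 0 s ∪ D.curve e '' Icc t 1)
    (hq : q ∉ D.curve e '' Icc 0 s ∪ D.curve e '' Icc t 1) :
    JoinedIn (D.supportOn S ∪ (D.curve e '' Icc 0 s ∪ D.curve e '' Icc t 1))ᶜ p q := by
  have hγ := isSimpleCurve_curve D he
  have hs1 : s < 1 := hst.trans_le unitInterval.le_one'
  have ht0 : 0 < t := unitInterval.nonneg'.trans_lt hst
  rw [mem_union, not_or] at hp hq
  have h₀ : JoinedIn (D.supportOn S ∪ D.curve e '' Icc 0 s)ᶜ p q :=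
    joinedIn_compl_union_image_Icc (isCompact_supportOn hV hE) hγ.continuous
      (hγ.injOn_Icc (.inr (.inl hs1))) (subsingleton_supportOn_inter_image_Icc he heS (.inr hs1)) h
      hp.1 hq.1
  rw [← union_assoc]
  refine joinedIn_compl_union_image_Icc
    ((isCompact_supportOn hV hE).union (isCompact_Icc.image hγ.continuous)) hγ.continuous
    (hγ.injOn_Icc (.inl ht0)) ?_ h₀ hp.2 hq.2
  refine (subsingleton_supportOn_inter_image_Icc (D := D) (t := 1) he heS (.inl ht0)).anti ?_
  rintro _ ⟨hu | ⟨u, hu, huv⟩, v, hv, rfl⟩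
  · exact ⟨hu, v, hv, rfl⟩
  · have huv' : u ≠ v := (hu.2.trans_lt (hst.trans_le hv.1)).ne
    exact ⟨huv ▸ Or.inl (curve_end_mem_image_point he fun h => huv' (hγ.eq_of_apply_eq u h v huv)),
      v, hv, rfl⟩

-- A path from `F` to the interior of `e` avoids the rest of the drawing, and by the theorem of
-- Janiszewski also the parts of `e` before `s` and after `t`.
theorem exists_curve_mem_closure (hV : V(G).Finite) (hE : E(G).Finite) (he : e ∈ E(G))
    (hF : D.IsFace F) (hz : z ∈ F) (hze : z ∈ D.edgeRegion e) (hst : s < t) :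
    ∃ u ∈ Ioo s t, D.curve e u ∈ closure F := by
  obtain ⟨u, hsu, hut⟩ := exists_between hst
  have hu : u ∈ Ioo 0 1 :=
    ⟨unitInterval.nonneg'.trans_lt hsu, hut.trans_le unitInterval.le_one'⟩
  have hγ := isSimpleCurve_curve D he
  have hends : ∀ {p}, p ∈ D.curve e '' Icc 0 s ∪ D.curve e '' Icc t 1 → p ∈ range (D.curve e) :=
    fun h => h.elim (fun h => image_subset_range _ _ h) fun h => image_subset_range _ _ h
  have hjoin : JoinedIn (D.supportOn {e}ᶜ ∪ (D.curve e '' Icc 0 s ∪ D.curve e '' Icc t 1))ᶜ z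
      (D.curve e u) := by
    refine joinedIn_compl_supportOn_union_ends hV hE he (not_not.2 rfl) hst
      (joinedIn_of_mem_edgeRegion hV hE he hze (curve_mem_edgeRegion he hu)) (fun h => ?_) ?_
    · exact hF.subset hz (supportOn_compl_singleton_union he ▸ Or.inr (hends h))
    · rintro (⟨v, hv, hvu⟩ | ⟨v, hv, hvu⟩)
      · exact (hv.2.trans_lt hsu).ne' (hγ.eq_of_apply_eq u hu v hvu.symm)
      · exact (hut.trans_le hv.1).ne (hγ.eq_of_apply_eq u hu v hvu.symm)
  by_contra! hcl
  have hsub : closure F ∩ range hjoin.somePath ⊆ F := by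
    rintro _ ⟨hyF, r, rfl⟩
    by_contra hy
    have hy : hjoin.somePath r ∈ frontier F := (hF.isOpen hV hE).frontier_eq.symm ▸ ⟨hyF, hy⟩
    rcases supportOn_compl_singleton_union he ▸ hF.frontier_subset hV hE hy with h | ⟨v, hv⟩
    · exact hjoin.somePath_mem r (Or.inl h)
    · refine hcl v ⟨not_le.1 fun h => ?_, not_le.1 fun h => ?_⟩ (hv ▸ hyF) <;>
        refine hjoin.somePath_mem r (Or.inr ?_)
      · exact Or.inl ⟨v, ⟨unitInterval.nonneg', h⟩, hv⟩
      · exact Or.inr ⟨v, ⟨h, unitInterval.le_one'⟩, hv⟩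
  have huF : D.curve e u ∈ F :=
    (isPreconnected_range hjoin.somePath.continuous).subset_of_closure_inter_subset
      (hF.isOpen hV hE) ⟨z, ⟨0, hjoin.somePath.source⟩, hz⟩ hsub ⟨1, hjoin.somePath.target⟩
  exact hcl u ⟨hsu, hut⟩ (subset_closure huF)

theorem isBoundaryEdge_of_mem_edgeRegion (hV : V(G).Finite) (hE : E(G).Finite) (he : e ∈ E(G))
    (hF : D.IsFace F) (hz : z ∈ F) (hze : z ∈ D.edgeRegion e) : D.IsBoundaryEdge e F := by
  have hdense : Dense (D.curve e ⁻¹' closure F) := dense_of_exists_between fun s t hst =>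
    let ⟨u, hu, huF⟩ := exists_curve_mem_closure hV hE he hF hz hze hst
    ⟨u, huF, hu⟩
  have huniv := (isClosed_closure.preimage (D.curve_continuous e he)).closure_eq ▸ hdense.closure_eq
  refine ⟨he, ?_⟩
  rw [(hF.isOpen hV hE).frontier_eq]
  rintro _ ⟨t, rfl⟩
  exact ⟨eq_univ_iff_forall.1 huniv t,
    fun h => hF.subset h (supportOn_compl_singleton_union he ▸ Or.inr ⟨t, rfl⟩)⟩

theorem exists_isFace_inter_nonempty (hV : V(G).Finite) (hE : E(G).Finite) {U : Set ℂ}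
    (hU : IsOpen U) (hne : U.Nonempty) : ∃ F, D.IsFace F ∧ (F ∩ U).Nonempty := by
  obtain ⟨z, hzU, hz⟩ := (dense_compl_support (D := D) hV hE).inter_open_nonempty U hU hne
  exact ⟨_, isFace_connectedComponentIn hz, z, mem_connectedComponentIn hz, hzU⟩

theorem exists_isBoundaryEdge (hV : V(G).Finite) (hE : E(G).Finite) (he : e ∈ E(G)) :
    ∃ F, D.IsFace F ∧ D.IsBoundaryEdge e F := by
  obtain ⟨t, ht⟩ := exists_mem_Ioo
  obtain ⟨F, hF, z, hz, hze⟩ := exists_isFace_inter_nonempty (D := D) hV hE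
    (isOpen_edgeRegion hV hE) ⟨_, curve_mem_edgeRegion he ht⟩
  exact ⟨F, hF, isBoundaryEdge_of_mem_edgeRegion hV hE he hF hz hze⟩

theorem supportOn_union_image_Icc_inter (he : e ∈ E(G)) (hs : s ∈ Ioo 0 1) :
    (D.supportOn {e}ᶜ ∪ D.curve e '' Icc 0 s) ∩ D.curve e '' Icc s 1 =
      {D.curve e s, D.curve e 1} := by
  refine Subset.antisymm ?_ (pair_subset
    ⟨.inr ⟨s, ⟨hs.1.le, le_rfl⟩, rfl⟩, s, ⟨le_rfl, hs.2.le⟩, rfl⟩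
    ⟨.inl (.inl (curve_end_mem_image_point he (by simp))), 1, ⟨hs.2.le, le_rfl⟩, rfl⟩)
  rintro _ ⟨hu, u, ⟨hsu, hu1⟩, rfl⟩
  rcases hu1.eq_or_lt with rfl | hu1
  · exact .inr rfl
  · have hu01 : u ∈ Ioo 0 1 := ⟨hs.1.trans_le hsu, hu1⟩
    rcases hu with hu | ⟨v, hv, hvu⟩
    · exact absurd hu (curve_notMem_supportOn he (not_not.2 rfl) hu01)
    · obtain rfl := (isSimpleCurve_curve D he).eq_of_apply_eq u hu01 v hvu.symm
      exact .inl (congrArg _ (le_antisymm hv.2 hsu))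

-- Split the edge `e` at an interior point: the drawing is the union of two compact sets that share
-- two points, and neither of them separates the faces along `e` from each other.
theorem exists_eq_of_isBoundaryEdge (hV : V(G).Finite) (hE : E(G).Finite) {F : Fin 3 → Set ℂ}
    (hF : ∀ i, D.IsFace (F i)) (he : ∀ i, D.IsBoundaryEdge e (F i)) : ∃ i j, i ≠ j ∧ F i = F j := by
  have heG := (he 0).1
  have hγ := isSimpleCurve_curve D heG
  obtain ⟨s, hs⟩ := exists_mem_Ioo
  choose p hp using fun i => (hF i).nonempty
  have hpγ : ∀ i, p i ∉ range (D.curve e) := fun i h =>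
    (hF i).subset (hp i) (supportOn_compl_singleton_union heG ▸ Or.inr h)
  have hpA : ∀ i j, JoinedIn (D.supportOn {e}ᶜ ∪ D.curve e '' Icc 0 s)ᶜ (p i) (p j) := fun i j =>
    joinedIn_compl_union_image_Icc (isCompact_supportOn hV hE) hγ.continuous
      (hγ.injOn_Icc (.inr (.inl hs.2)))
      (subsingleton_supportOn_inter_image_Icc heG (not_not.2 rfl) (.inr hs.2))
      (joinedIn_of_mem_edgeRegion hV hE heG ((he i).subset_edgeRegion hV hE (hF i) (hp i))
        ((he j).subset_edgeRegion hV hE (hF j) (hp j)))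
      (fun h => hpγ i (image_subset_range _ _ h)) (fun h => hpγ j (image_subset_range _ _ h))
  have hpB : ∀ i j, JoinedIn (D.curve e '' Icc s 1)ᶜ (p i) (p j) := fun i j =>
    joinedIn_compl_image_Icc hγ.continuous (hγ.injOn_Icc (.inl hs.1))
      (fun h => hpγ i (image_subset_range _ _ h)) (fun h => hpγ j (image_subset_range _ _ h))
  have hunion : D.supportOn {e}ᶜ ∪ D.curve e '' Icc 0 s ∪ D.curve e '' Icc s 1 = D.support := by
    rw [union_assoc, ← image_union, Icc_union_Icc_eq_Icc hs.1.le hs.2.le,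
      ← unitInterval.univ_eq_Icc, image_univ, supportOn_compl_singleton_union heG]
  obtain ⟨i, j, hij, h⟩ := exists_joinedIn_compl_union_of_inter_eq_pair
    ((isCompact_supportOn hV hE).union (isCompact_Icc.image hγ.continuous))
    (isCompact_Icc.image hγ.continuous) (supportOn_union_image_Icc_inter heG hs) hpA hpB
  exact ⟨i, j, hij, (hF i).eq_of_joinedIn hV hE (hF j) (hp i) (hp j) (hunion ▸ h)⟩

/-! ### Duality of connectedness -/

theorem isLink_of_isBoundaryEdge (hV : V(G).Finite) (hE : E(G).Finite) (hF : D.IsFace F)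
    (hF' : D.IsFace F') (h : D.IsBoundaryEdge e F) (h' : D.IsBoundaryEdge e F') (hne : F ≠ F') :
    D.dual.IsLink e F F' := by
  refine ⟨h.1, hF, hF', fun H hH => ⟨fun hHe => ?_, ?_⟩⟩
  · by_contra! hHne
    obtain ⟨i, j, hij, hFij⟩ := exists_eq_of_isBoundaryEdge (D := D) (e := e)
      (F := ![F, F', H]) hV hE
      (by simp [Fin.forall_fin_succ, hF, hF', hH]) (by simp [Fin.forall_fin_succ, h, h', hHe])
    fin_cases i <;> fin_cases j <;> simp_all
  · rintro (rfl | rfl) <;> assumption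

theorem exists_dual_isLink (hV : V(G).Finite) (hE : E(G).Finite) (he : e ∈ E(G)) :
    ∃ F F', D.dual.IsLink e F F' := by
  obtain ⟨F, hF, hFe⟩ := exists_isBoundaryEdge (D := D) hV hE he
  by_cases h : ∃ F', D.IsFace F' ∧ D.IsBoundaryEdge e F' ∧ F ≠ F'
  · obtain ⟨F', hF', hFe', hne⟩ := h
    exact ⟨F, F', isLink_of_isBoundaryEdge hV hE hF hF' hFe hFe' hne⟩
  · push Not at h
    exact ⟨F, F, he, hF, hF, fun H hH =>
      ⟨fun hHe => .inl (h H hH hHe).symm, by rintro (rfl | rfl) <;> exact hFe⟩⟩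

theorem isBoundaryEdge_of_isLink (h : D.dual.IsLink e F F') : D.IsBoundaryEdge e F :=
  (h.2.2.2 F h.2.1).2 (.inl rfl)

-- For `z` off the drawing, `U` is the face of `z`; for `z` on an edge, `U` is its edge region.
theorem exists_isOpen_forall_reachable (hV : V(G).Finite) (hE : E(G).Finite)
    (hz : z ∉ D.supportOn S) : ∃ U, IsOpen U ∧ IsPreconnected U ∧ z ∈ U ∧ U ⊆ (D.supportOn S)ᶜ ∧
      ∀ F F', D.IsFace F → D.IsFace F' → (F ∩ U).Nonempty → (F' ∩ U).Nonempty →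
        (D.dual.restrict Sᶜ).Reachable F F' := by
  by_cases hzD : z ∈ D.support
  · obtain ⟨e, he, t, rfl⟩ := mem_iUnion₂.1 (hzD.resolve_left fun h => hz (.inl h))
    have heS : e ∉ S := fun heS => hz (curve_mem_supportOn he heS)
    refine ⟨D.edgeRegion e, isOpen_edgeRegion hV hE, isPreconnected_edgeRegion he,
      curve_mem_edgeRegion he (mem_Ioo_of_curve_notMem_supportOn he hz), edgeRegion_subset.trans
        (compl_subset_compl.2 (supportOn_mono (subset_compl_singleton_iff.2 heS))), ?_⟩
    rintro F F' hF hF' ⟨p, hp, hpe⟩ ⟨q, hq, hqe⟩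
    rcases eq_or_ne F F' with rfl | hne
    · exact .refl hF
    · exact .of_isLink <| (restrict_isLink ..).mpr ⟨heS, isLink_of_isBoundaryEdge hV hE hF hF'
        (isBoundaryEdge_of_mem_edgeRegion hV hE he hF hp hpe)
        (isBoundaryEdge_of_mem_edgeRegion hV hE he hF' hq hqe) hne⟩
  · refine ⟨connectedComponentIn D.supportᶜ z,
      (isCompact_support hV hE).isClosed.isOpen_compl.connectedComponentIn,
      isPreconnected_connectedComponentIn, mem_connectedComponentIn hzD,
      (connectedComponentIn_subset _ _).trans (compl_subset_compl.2 supportOn_subset_support), ?_⟩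
    rintro F F' hF hF' ⟨p, hp, hpz⟩ ⟨q, hq, hqz⟩
    obtain rfl : F = F' := by
      rw [hF.eq_connectedComponentIn hp, hF'.eq_connectedComponentIn hq,
        ← connectedComponentIn_eq hpz, connectedComponentIn_eq hqz]
    exact .refl hF

theorem joinedIn_of_reachable (hV : V(G).Finite) (hE : E(G).Finite)
    (h : (D.dual.restrict Sᶜ).Reachable F F') {p q : ℂ} (hp : p ∈ F) (hq : q ∈ F') :
    JoinedIn (D.supportOn S)ᶜ p q := by
  obtain ⟨hF : D.IsFace F, h⟩ := h
  induction h generalizing q with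
  | refl =>
    have hpq := (isPreconnected_iff_forall_joinedIn (hF.isOpen hV hE)).1 hF.isPreconnected p hp q hq
    exact hpq.mono (hF.subset.trans (compl_subset_compl.2 supportOn_subset_support))
  | tail _ hadj ih =>
    obtain ⟨e, heS, he⟩ := hadj
    obtain ⟨r, hr⟩ := he.2.1.nonempty
    refine (ih hr).trans <| (joinedIn_of_mem_edgeRegion hV hE he.1
      ((isBoundaryEdge_of_isLink he).subset_edgeRegion hV hE he.2.1 hr)
      ((isBoundaryEdge_of_isLink he.symm).subset_edgeRegion hV hE he.2.2.1 hq)).mono ?_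
    exact compl_subset_compl.2 (supportOn_mono (subset_compl_singleton_iff.2 heS))

theorem isPreconnected_compl_supportOn (hV : V(G).Finite) (hE : E(G).Finite)
    (h : (D.dual.restrict Sᶜ).IsConnected) : IsPreconnected (D.supportOn S)ᶜ := by
  have hface : ∀ z ∉ D.supportOn S, ∃ F, D.IsFace F ∧ ∃ p ∈ F, JoinedIn (D.supportOn S)ᶜ z p := by
    intro z hz
    obtain ⟨U, hUo, hUp, hzU, hUS, -⟩ := exists_isOpen_forall_reachable hV hE hz
    obtain ⟨F, hF, p, hp, hpU⟩ := exists_isFace_inter_nonempty (D := D) hV hE hUo ⟨z, hzU⟩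
    exact ⟨F, hF, p, hp,
      ((isPreconnected_iff_forall_joinedIn hUo).1 hUp z hzU p hpU).mono hUS⟩
  refine (isPreconnected_iff_forall_joinedIn (isOpen_compl_supportOn hV hE)).2 fun z hz w hw => ?_
  obtain ⟨F, hF, p, hp, hzp⟩ := hface z hz
  obtain ⟨F', hF', q, hq, hwq⟩ := hface w hw
  exact (hzp.trans (joinedIn_of_reachable hV hE (h.2 F hF F' hF') hp hq)).trans hwq.symm

theorem isConnected_dual_restrict_compl (hV : V(G).Finite) (hE : E(G).Finite)
    (h : IsPreconnected (D.supportOn S)ᶜ) : (D.dual.restrict Sᶜ).IsConnected := by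
  choose! U hUo _ hzU _ hU using fun z (hz : z ∉ D.supportOn S) =>
    exists_isOpen_forall_reachable hV hE hz
  obtain ⟨F₀, hF₀, -⟩ := exists_isFace_inter_nonempty (D := D) hV hE isOpen_univ univ_nonempty
  refine ⟨⟨F₀, hF₀⟩, fun F (hF : D.IsFace F) F' (hF' : D.IsFace F') => ?_⟩
  obtain ⟨p, hp⟩ := hF.nonempty
  obtain ⟨q, hq⟩ := hF'.nonempty
  have hpS : p ∉ D.supportOn S := fun h => hF.subset hp (supportOn_subset_support h)
  have hqS : q ∉ D.supportOn S := fun h => hF'.subset hq (supportOn_subset_support h)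
  refine h.induction₂ (fun z w => ∀ F F', D.IsFace F → D.IsFace F' → (F ∩ U z).Nonempty →
    (F' ∩ U w).Nonempty → (D.dual.restrict Sᶜ).Reachable F F') (fun z hz => ?_) ?_ ?_ hpS hqS F F'
    hF hF' ⟨p, hp, hzU p hpS⟩ ⟨q, hq, hzU q hqS⟩
  · filter_upwards [self_mem_nhdsWithin,
      mem_nhdsWithin_of_mem_nhds ((hUo z hz).mem_nhds (hzU z hz))]
      with w hw hwU F F' hF hF' hFz hF'w
    obtain ⟨H, hH, v, hv, hvz, hvw⟩ := exists_isFace_inter_nonempty (D := D) hV hE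
      ((hUo z hz).inter (hUo w hw)) ⟨w, hwU, hzU w hw⟩
    exact (hU z hz F H hF hH hFz ⟨v, hv, hvz⟩).trans (hU w hw H F' hH hF' ⟨v, hv, hvw⟩ hF'w)
  · intro u v w _ hv _ huv hvw F F' hF hF' hFu hF'w
    obtain ⟨H, hH, hHv⟩ := exists_isFace_inter_nonempty (D := D) hV hE (hUo v hv) ⟨v, hzU v hv⟩
    exact (huv F H hF hH hFu hHv).trans (hvw H F' hH hF' hHv hF'w)
  · exact fun u v _ _ huv F F' hF hF' hFv hF'u => (huv F' F hF' hF hF'u hFv).symm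

/-! ### Cycles separate the plane, forests do not -/

theorem joinedIn_range_curve (h : G.IsLink e x y) :
    JoinedIn (range (D.curve e)) (D.point x) (D.point y) := by
  obtain ⟨x', y', h', h0, h1⟩ := D.curve_ends e h.edge_mem
  have hjoin := (joinedIn_image_Icc (D.curve_continuous e h.edge_mem)
    (unitInterval.nonneg' : 0 ≤ (1 : I))).mono (image_subset_range _ _)
  rw [h0, h1] at hjoin
  rcases h.eq_and_eq_or_eq_and_eq h' with ⟨rfl, rfl⟩ | ⟨rfl, rfl⟩
  exacts [hjoin, hjoin.symm]

theorem joinedIn_supportOn_of_reachable (h : (G.restrict S).Reachable x y) :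
    JoinedIn (D.supportOn S) (D.point x) (D.point y) := by
  obtain ⟨hx, h⟩ := h
  induction h with
  | refl => exact JoinedIn.refl (point_mem_supportOn hx)
  | tail _ hadj ih =>
    obtain ⟨e, heS, he⟩ := hadj
    exact ih.trans ((joinedIn_range_curve he).mono
      (range_subset_iff.2 fun _ => curve_mem_supportOn he.edge_mem heS))

theorem joinedIn_curve_ends_of_reachable (hxy : G.IsLink e x y)
    (h : (G.restrict S).Reachable x y) : JoinedIn (D.supportOn S) (D.curve e 0) (D.curve e 1) := by
  obtain ⟨x', y', h', h0, h1⟩ := D.curve_ends e hxy.edge_mem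
  rw [h0, h1]
  rcases h'.eq_and_eq_or_eq_and_eq hxy with ⟨rfl, rfl⟩ | ⟨rfl, rfl⟩
  exacts [joinedIn_supportOn_of_reachable h, (joinedIn_supportOn_of_reachable h).symm]

theorem not_isPreconnected_compl_supportOn (hV : V(G).Finite) (hE : E(G).Finite)
    (hxy : G.IsLink e x y) (heS : e ∉ S) (h : (G.restrict S).Reachable x y) :
    ¬ IsPreconnected (D.supportOn (insert e S))ᶜ := by
  have he := hxy.edge_mem
  have hγ := isSimpleCurve_curve D he
  obtain ⟨a, ha0, ha1⟩ := exists_mem_Ioo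
  obtain ⟨b, hab, hb1⟩ := exists_between ha1
  have hIcc : ∀ s t, IsClosed (D.curve e '' Icc s t) := fun s t =>
    (isCompact_Icc.image hγ.continuous).isClosed
  have hunion : D.curve e '' Icc a b ∪
      (D.supportOn S ∪ (D.curve e '' Icc 0 a ∪ D.curve e '' Icc b 1)) =
      D.supportOn (insert e S) := by
    rw [supportOn_insert he, union_left_comm, union_left_comm (D.curve e '' Icc a b), ← image_union,
      ← image_union, Icc_union_Icc_eq_Icc hab.le hb1.le, Icc_union_Icc_eq_Icc ha0.le ha1.le,
      ← unitInterval.univ_eq_Icc, image_univ]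
  rw [← hunion]
  refine not_isPreconnected_compl_union (hIcc a b)
    ((isCompact_supportOn hV hE).isClosed.union ((hIcc 0 a).union (hIcc b 1)))
    (fun h => hab.ne (hγ.eq_of_apply_eq a ⟨ha0, ha1⟩ b h)) (joinedIn_image_Icc hγ.continuous hab.le)
    ?_ (Subset.antisymm ?_ ?_)
  · exact (((joinedIn_image_Icc hγ.continuous ha0.le).symm.mono fun _ h => .inr (.inl h)).trans
      ((joinedIn_curve_ends_of_reachable hxy h).mono subset_union_left)).trans
      ((joinedIn_image_Icc hγ.continuous hb1.le).symm.mono fun _ h => .inr (.inr h))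
  · rintro _ ⟨⟨u, hu, rfl⟩, huB⟩
    have hu01 : u ∈ Ioo 0 1 := ⟨ha0.trans_le hu.1, hu.2.trans_lt hb1⟩
    rcases huB with huS | ⟨v, hv, hvu⟩ | ⟨v, hv, hvu⟩
    · exact absurd huS (curve_notMem_supportOn he heS hu01)
    · obtain rfl := hγ.eq_of_apply_eq u hu01 v hvu.symm
      exact .inl (congrArg _ (le_antisymm hv.2 hu.1))
    · obtain rfl := hγ.eq_of_apply_eq u hu01 v hvu.symm
      exact .inr (congrArg _ (le_antisymm hu.2 hv.1))
  · exact pair_subset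
      ⟨⟨a, ⟨le_rfl, hab.le⟩, rfl⟩, .inr (.inl ⟨a, ⟨ha0.le, le_rfl⟩, rfl⟩)⟩
      ⟨⟨b, ⟨hab.le, le_rfl⟩, rfl⟩, .inr (.inr ⟨b, ⟨le_rfl, hb1.le⟩, rfl⟩)⟩

theorem not_reachable_of_isConnected_dual (hV : V(G).Finite) (hE : E(G).Finite)
    (h : (D.dual.restrict Sᶜ).IsConnected) (heS : e ∈ S) (hxy : G.IsLink e x y) :
    ¬ (G.restrict (S \ {e})).Reachable x y := fun hreach =>
  not_isPreconnected_compl_supportOn (D := D) hV hE hxy (fun h => h.2 rfl) hreach <| by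
    rw [insert_sdiff_self_of_mem heS]
    exact isPreconnected_compl_supportOn hV hE h

variable (D S v) in
/-- The part of the drawing that consists of the vertex `v` and the edges in `S` at `v`. -/
def star : Set ℂ := {D.point v} ∪ ⋃ f ∈ {f ∈ S | G.Inc f v}, range (D.curve f)

theorem isCompact_star (hE : E(G).Finite) : IsCompact (D.star S v) :=
  isCompact_singleton.union <| (hE.subset fun _ hf => hf.2.edge_mem).isCompact_biUnion fun f hf =>
    isCompact_range (D.curve_continuous f hf.2.edge_mem)

theorem iUnion_star : ⋃ v ∈ V(G), D.star S v = D.supportOn S := by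
  refine Subset.antisymm (iUnion₂_subset fun v hv => union_subset
    (singleton_subset_iff.2 (point_mem_supportOn hv)) (iUnion₂_subset fun f hf =>
      range_subset_iff.2 fun _ => curve_mem_supportOn hf.2.edge_mem hf.1)) ?_
  rintro _ (⟨v, hv, rfl⟩ | h)
  · exact mem_biUnion hv (.inl rfl)
  · obtain ⟨f, ⟨hf, hfS⟩, t, rfl⟩ := mem_iUnion₂.1 h
    obtain ⟨v, w, hvw⟩ := exists_isLink_of_mem_edgeSet hf
    exact mem_biUnion hvw.left_mem (.inr (mem_biUnion ⟨hfS, w, hvw⟩ ⟨t, rfl⟩))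

theorem reachable_of_inc_of_inc {f : β} (hfS : f ∈ S) (hv : G.Inc f v) (hw : G.Inc f w) :
    (G.restrict S).Reachable v w := by
  obtain ⟨u, hu⟩ := hv
  rcases hw.eq_or_eq_of_isLink hu with rfl | rfl
  · exact .refl hu.left_mem
  · exact .of_isLink ⟨hfS, hu⟩

theorem exists_of_mem_star (hv : v ∈ V(G)) (hz : z ∈ D.star S v) :
    (∃ u, (G.restrict S).Reachable v u ∧ D.point u = z) ∨
      ∃ f ∈ S, G.Inc f v ∧ ∃ t ∈ Ioo 0 1, D.curve f t = z := by
  rcases hz with rfl | hz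
  · exact .inl ⟨v, .refl hv, rfl⟩
  · obtain ⟨f, ⟨hfS, hfv⟩, t, rfl⟩ := mem_iUnion₂.1 hz
    by_cases ht : t ∈ Ioo 0 1
    · exact .inr ⟨f, hfS, hfv, t, ht, rfl⟩
    · obtain ⟨u, hfu, hu⟩ := exists_inc_point_eq_curve hfv.edge_mem ht
      exact .inl ⟨u, reachable_of_inc_of_inc hfS hfv hfu, hu⟩

theorem reachable_of_mem_star (hv : v ∈ V(G)) (hw : w ∈ V(G)) (hzv : z ∈ D.star S v)
    (hzw : z ∈ D.star S w) : (G.restrict S).Reachable v w := by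
  rcases exists_of_mem_star hv hzv with ⟨u, hvu, rfl⟩ | ⟨f, hfS, hfv, t, ht, rfl⟩ <;>
    rcases exists_of_mem_star hw hzw with ⟨u', hwu', h⟩ | ⟨f', -, hfw, t', ht', h⟩
  · rw [D.point_injOn hwu'.right_mem hvu.right_mem h] at hwu'
    exact hvu.trans hwu'.symm
  · exact absurd h (D.curve_ne_point f' hfw.edge_mem t' ht' u hvu.right_mem)
  · exact absurd h.symm (D.curve_ne_point f hfv.edge_mem t ht u' hwu'.right_mem)
  · rw [← eq_of_curve_eq_curve hfv.edge_mem hfw.edge_mem ht h.symm] at hfw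
    exact reachable_of_inc_of_inc hfS hfv hfw

theorem exists_disjoint_union_eq_supportOn (hV : V(G).Finite) (hE : E(G).Finite) (hx : x ∈ V(G))
    (hy : y ∈ V(G)) (h : ¬ (G.restrict S).Reachable x y) :
    ∃ P Q, IsCompact P ∧ IsCompact Q ∧ Disjoint P Q ∧ P ∪ Q = D.supportOn S ∧
      D.point x ∈ P ∧ D.point y ∈ Q := by
  set C := (G.restrict S).component x
  refine ⟨⋃ v ∈ V(G) ∩ C, D.star S v, ⋃ v ∈ V(G) \ C, D.star S v,
    (hV.inter_of_left C).isCompact_biUnion fun _ _ => isCompact_star hE,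
    hV.sdiff.isCompact_biUnion fun _ _ => isCompact_star hE, ?_, ?_,
    mem_biUnion ⟨hx, .refl hx⟩ (.inl rfl), mem_biUnion ⟨hy, h⟩ (.inl rfl)⟩
  · refine disjoint_left.2 fun z hzP hzQ => ?_
    obtain ⟨v, ⟨hv, hvC⟩, hzv⟩ := mem_iUnion₂.1 hzP
    obtain ⟨w, ⟨hw, hwC⟩, hzw⟩ := mem_iUnion₂.1 hzQ
    exact hwC (hvC.trans (reachable_of_mem_star hv hw hzv hzw))
  · rw [← biUnion_union, inter_union_sdiff, iUnion_star]

theorem eq_point_or_eq_point_of_mem (hxy : G.IsLink e x y) (heS : e ∉ S)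
    (hz : z ∈ range (D.curve e)) (hzS : z ∈ D.supportOn S) : z = D.point x ∨ z = D.point y := by
  obtain ⟨t, rfl⟩ := hz
  obtain ⟨u, heu, hu⟩ := exists_inc_point_eq_curve (D := D) hxy.edge_mem fun ht =>
    curve_notMem_supportOn hxy.edge_mem heS ht hzS
  rw [← hu]
  exact (heu.eq_or_eq_of_isLink hxy).imp (congrArg _) (congrArg _)

theorem curve_zero_ne_curve_one (hxy : G.IsLink e x y) (hne : x ≠ y) :
    D.curve e 0 ≠ D.curve e 1 := by
  obtain ⟨x', y', h', h0, h1⟩ := D.curve_ends e hxy.edge_mem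
  rw [h0, h1]
  refine fun h => hne ?_
  obtain rfl := D.point_injOn h'.left_mem h'.right_mem h
  rcases hxy.eq_and_eq_or_eq_and_eq h' with ⟨rfl, rfl⟩ | ⟨rfl, rfl⟩ <;> rfl

-- The compact sets `P`, `range (D.curve e)` and `Q` are attached to each other at one point, so by
-- the theorem of Janiszewski their union separates only points which one of them separates.
theorem isConnected_dual_restrict_compl_insert (hV : V(G).Finite) (hE : E(G).Finite)
    (h : (D.dual.restrict Sᶜ).IsConnected) (hxy : G.IsLink e x y)
    (hreach : ¬ (G.restrict S).Reachable x y) : (D.dual.restrict (insert e S)ᶜ).IsConnected := by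
  have heS : e ∉ S := fun heS => hreach (.of_isLink ⟨heS, hxy⟩)
  have hne : x ≠ y := fun hne => hreach (hne ▸ .refl hxy.left_mem)
  obtain ⟨P, Q, hP, hQ, hPQ, hunion, hxP, hyQ⟩ :=
    exists_disjoint_union_eq_supportOn (D := D) hV hE hxy.left_mem hxy.right_mem hreach
  have hγ := isSimpleCurve_curve D hxy.edge_mem
  have hrange : D.curve e '' Icc 0 1 = range (D.curve e) := by
    rw [← unitInterval.univ_eq_Icc, image_univ]
  have hPe : ∀ z ∈ P, z ∈ range (D.curve e) → z = D.point x := fun z hzP hze =>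
    (eq_point_or_eq_point_of_mem hxy heS hze (hunion ▸ .inl hzP)).resolve_right fun hzy =>
      disjoint_left.1 hPQ hzP (hzy ▸ hyQ)
  have hQe : ∀ z ∈ Q, z ∈ range (D.curve e) → z = D.point y := fun z hzQ hze =>
    (eq_point_or_eq_point_of_mem hxy heS hze (hunion ▸ .inr hzQ)).resolve_left fun hzx =>
      disjoint_left.1 hPQ (hzx ▸ hxP) hzQ
  have hunion' : D.supportOn (insert e S) = P ∪ D.curve e '' Icc 0 1 ∪ Q := by
    rw [supportOn_insert hxy.edge_mem, ← hunion, hrange, union_right_comm]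
  refine isConnected_dual_restrict_compl hV hE <|
    (isPreconnected_iff_forall_joinedIn (isOpen_compl_supportOn hV hE)).2 fun z hz w hw => ?_
  rw [hunion'] at hz hw ⊢
  have hzw : JoinedIn (D.supportOn S)ᶜ z w :=
    (isPreconnected_iff_forall_joinedIn (isOpen_compl_supportOn hV hE)).1
      (isPreconnected_compl_supportOn hV hE h) z
      (fun h => hz (by rw [← hunion] at h; exact h.imp_left .inl)) w
      (fun h => hw (by rw [← hunion] at h; exact h.imp_left .inl))
  have hPzw : JoinedIn (P ∪ D.curve e '' Icc 0 1)ᶜ z w :=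
    joinedIn_compl_union_image_Icc hP hγ.continuous
      (hγ.injOn_Icc (.inr (.inr (curve_zero_ne_curve_one hxy hne))))
      (hrange ▸ fun p hp q hq => (hPe p hp.1 hp.2).trans (hPe q hq.1 hq.2).symm)
      (hzw.mono (compl_subset_compl.2 (hunion ▸ subset_union_left)))
      (fun h => hz (.inl (.inr h))) (fun h => hw (.inl (.inr h)))
  refine joinedIn_compl_union (hP.union (isCompact_Icc.image hγ.continuous)) hQ
    (Subsingleton.isPreconnected ?_) hPzw
    (hzw.mono (compl_subset_compl.2 (hunion ▸ subset_union_right)))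
  rw [union_inter_distrib_right, hPQ.inter_eq, empty_union, hrange]
  exact fun p hp q hq => (hQe p hp.2 hp.1).trans (hQe q hq.2 hq.1).symm

/-! ### The absolute index as a distance in the dual graph -/

theorem isConnected_dual (hV : V(G).Finite) (hE : E(G).Finite) : D.dual.IsConnected := by
  have hempty : D.supportOn ∅ = D.point '' V(G) := by
    rw [supportOn, inter_empty, biUnion_empty, union_empty]
  have hpre : IsPreconnected (D.supportOn ∅)ᶜ := hempty ▸
    ((hV.image _).countable.isConnected_compl_of_one_lt_rank
      (by rw [Complex.rank_real_complex]; exact Nat.one_lt_ofNat)).isPreconnected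
  exact (isConnected_dual_restrict_compl hV hE hpre).mono restrict_le rfl

theorem exists_isExteriorFace (hV : V(G).Finite) (hE : E(G).Finite) :
    ∃ O, D.IsExteriorFace O := by
  obtain ⟨p, hp, hub⟩ := exists_not_isBounded_connectedComponentIn
    (isCompact_support (D := D) hV hE).isBounded
  exact ⟨_, isFace_connectedComponentIn hp, hub⟩

theorem IsExteriorFace.eq (hV : V(G).Finite) (hE : E(G).Finite) (hO : D.IsExteriorFace O)
    (hO' : D.IsExteriorFace O') : O = O' := by
  obtain ⟨⟨p, -, rfl⟩, hp⟩ := hO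
  obtain ⟨⟨q, -, rfl⟩, hq⟩ := hO'
  exact connectedComponentIn_eq_of_not_isBounded
    (isCompact_support hV hE).isBounded hp hq

theorem isOuterEdge_of_isLink (hV : V(G).Finite) (hE : E(G).Finite) (hO : D.IsExteriorFace O)
    (h : D.dual.IsLink e O F) (hne : O ≠ F) : D.IsOuterEdge e :=
  ⟨⟨O, hO, isBoundaryEdge_of_isLink h⟩, F,
    ⟨h.right_mem, not_not.1 fun hF => hne (hO.eq hV hE ⟨h.right_mem, hF⟩)⟩,
    isBoundaryEdge_of_isLink h.symm⟩

theorem absoluteIndex_eq_graphDist (hV : V(G).Finite) (hE : E(G).Finite)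
    (hO : D.IsExteriorFace O) (hF : D.IsFace F) :
    D.absoluteIndex F = graphDist D.dual O F := by
  rw [absoluteIndex]
  split_ifs with hFO
  · rw [hO.eq hV hE hFO, graphDist, SimpleGraph.dist_self, Nat.cast_zero]
  refine le_antisymm ?_ (le_iInf₂ fun e _ => le_iInf₂ fun O' hO' => le_iInf₂ fun n hn => ?_)
  · obtain ⟨e, hpath⟩ := graphDist.exists_hasPathWithFirstEdge
      ((isConnected_dual hV hE).2 O hO.1 F hF) (fun h => hFO (h ▸ hO))
    obtain ⟨v, f, hpos, rfl, -, rfl, hinj, hf⟩ := id hpath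
    have hne : v 0 ≠ v 1 := hinj.ne (mem_Iic.2 hpos.le) (mem_Iic.2 hpos) zero_ne_one
    have houter : D.IsOuterEdge (f 0) := isOuterEdge_of_isLink hV hE hO (hf 0 hpos) hne
    exact (iInf₂_le (f 0) houter).trans ((iInf₂_le _ hO).trans (iInf₂_le _ hpath))
  · rw [hO.eq hV hE hO']
    exact Nat.cast_le.2 (graphDist.le_of_hasPathWithFirstEdge hn)

theorem isLink_of_areAdjacentFaces (hV : V(G).Finite) (hE : E(G).Finite)
    (h : D.AreAdjacentFaces F F') : ∃ e, D.dual.IsLink e F F' :=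
  let ⟨hF, hF', hne, e, he, he'⟩ := h
  ⟨e, isLink_of_isBoundaryEdge hV hE hF hF' he he' hne⟩

theorem absoluteIndex_add_le_maxIndexSum (h : D.dual.IsLink e F F') (hne : F ≠ F') :
    D.absoluteIndex F + D.absoluteIndex F' ≤ D.maxIndexSum :=
  le_iSup₂_of_le F F' <| le_iSup_of_le ⟨h.left_mem, h.right_mem, hne, e,
    isBoundaryEdge_of_isLink h, isBoundaryEdge_of_isLink h.symm⟩ le_rfl

theorem maxIndexSum_lt_top (hV : V(G).Finite) (hE : E(G).Finite) : D.maxIndexSum < ⊤ := by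
  obtain ⟨O, hO⟩ := exists_isExteriorFace (D := D) hV hE
  have := hE.to_subtype
  choose A B hAB using fun e : E(G) => exists_dual_isLink (D := D) hV hE e.2
  have hle : D.maxIndexSum ≤
      ⨆ e, ((graphDist D.dual O (A e) + graphDist D.dual O (B e) : ℕ) : ℕ∞) := by
    refine iSup₂_le fun F F' => iSup_le fun h => ?_
    obtain ⟨e, he⟩ := isLink_of_areAdjacentFaces hV hE h
    have heG : e ∈ E(G) := he.1
    refine le_iSup_of_le ⟨e, heG⟩ ?_
    rw [absoluteIndex_eq_graphDist hV hE hO h.1, absoluteIndex_eq_graphDist hV hE hO h.2.1]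
    rcases he.eq_and_eq_or_eq_and_eq (hAB ⟨e, heG⟩) with ⟨hA, hB⟩ | ⟨hB, hA⟩
    · rw [hA, hB, Nat.cast_add]
    · rw [hA, hB, Nat.cast_add, add_comm]
  exact hle.trans_lt (lt_top_iff_ne_top.2 (iSup_ne_top fun e => ENat.natCast_ne_top _))

/-! ### The spanning tree complementary to a shortest-path tree of the dual graph -/

theorem restrict_deleteEdges (G : Graph α β) (S T : Set β) :
    (G.restrict S).deleteEdges T = G.restrict (S \ T) :=
  Graph.ext rfl fun _ _ _ => and_right_comm

variable (τ : SearchTree D.dual O)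

theorem not_reachable_restrict_edges_compl_sdiff (hV : V(G).Finite) (hE : E(G).Finite)
    (hO : D.IsFace O) (he : e ∉ τ.edges) (hxy : G.IsLink e x y) :
    ¬ (G.restrict (τ.edgesᶜ \ {e})).Reachable x y :=
  not_reachable_of_isConnected_dual hV hE
    ((compl_compl τ.edges).symm ▸ τ.isConnected_restrict_edges hO) he hxy

variable {τ}

-- Adding `g` to `S` keeps the dual edges outside `S` connected; so one of them replaces `g` in the
-- tree, joining the part above `g` to the rest.
theorem exists_isLink_ancestors_of_not_reachable (hV : V(G).Finite) (hE : E(G).Finite)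
    (hO : D.IsFace O) (hS : S ⊆ τ.edgesᶜ) (hg : G.IsLink g a b) (hgτ : g ∈ τ.edges)
    (hab : ¬ (G.restrict S).Reachable a b) :
    ∃ H e F F', τ.parentEdge H = g ∧ e ∉ S ∧ e ∉ τ.edges ∧ D.dual.IsLink e F F' ∧
      H ∈ τ.ancestors F ∧ H ∉ τ.ancestors F' := by
  have hconn : (D.dual.restrict Sᶜ).IsConnected :=
    (τ.isConnected_restrict_edges hO).mono
      (restrict_mono_right _ (subset_compl_comm.1 hS)) rfl
  obtain ⟨H, ⟨hH, hHO⟩, rfl⟩ := hgτ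
  obtain ⟨e, he, F, F', hF, hHF, hHF', heτ⟩ := τ.exists_isLink_ancestors
    (isConnected_dual_restrict_compl_insert hV hE hconn hg hab) hO hH hHO
  exact ⟨H, e, F, F', rfl, fun h => he (.inr h), fun h => he (.inl (heτ h)), hF, hHF, hHF'⟩

variable (τ)

theorem isSpanningTree_restrict_edges_compl (hV : V(G).Finite) (hE : E(G).Finite)
    (hG : G.IsConnected) (hO : D.IsFace O) : (G.restrict τ.edgesᶜ).IsSpanningTree G := by
  refine ⟨⟨restrict_le, rfl⟩, IsConnected.isTree ⟨hG.1, fun x hx y hy => ?_⟩ fun e x y hxy => ?_⟩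
  · by_contra hn
    obtain ⟨g, a, b, hg, ha, hb⟩ := (hG.2 x hx y hy).exists_isLink_of_mem_of_notMem
      (A := (G.restrict τ.edgesᶜ).component x) (.refl hx) hn
    have hab : ¬ (G.restrict τ.edgesᶜ).Reachable a b := fun h => hb (ha.trans h)
    have hgτ : g ∈ τ.edges := not_not.1 fun h => hab (.of_isLink ⟨h, hg⟩)
    obtain ⟨-, e, -, -, -, he, he', -⟩ :=
      exists_isLink_ancestors_of_not_reachable hV hE hO Subset.rfl hg hgτ hab
    exact he he'
  · rw [restrict_deleteEdges]
    exact not_reachable_restrict_edges_compl_sdiff τ hV hE hO hxy.1 hxy.2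

theorem congestionSet_subset (hV : V(G).Finite) (hE : E(G).Finite) (hO : D.IsFace O)
    (hF : D.dual.IsLink e F F') :
    G.congestionSet (G.restrict τ.edgesᶜ) e ⊆
      insert e (τ.parentEdge '' (symmDiff (τ.ancestors F) (τ.ancestors F'))) := by
  rintro g ⟨x, y, ⟨he, hxy⟩, a, hxa, b, hyb, hg⟩
  refine or_iff_not_imp_left.2 fun hge => ?_
  rw [restrict_deleteEdges] at hxa hyb
  have hab : ¬ (G.restrict (τ.edgesᶜ \ {e})).Reachable a b := fun h =>
    not_reachable_restrict_edges_compl_sdiff τ hV hE hO he hxy ((hxa.trans h).trans hyb.symm)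
  have hgτ : g ∈ τ.edges := not_not.1 fun h => hab (.of_isLink ⟨⟨h, hge⟩, hg⟩)
  obtain ⟨H, e', F₁, F₁', hHg, he'S, he'τ, hF₁, hH, hH'⟩ :=
    exists_isLink_ancestors_of_not_reachable hV hE hO sdiff_subset hg hgτ hab
  obtain rfl : e' = e := not_not.1 fun h => he'S ⟨he'τ, h⟩
  refine ⟨H, ?_, hHg⟩
  rcases hF₁.eq_and_eq_or_eq_and_eq hF with ⟨rfl, rfl⟩ | ⟨rfl, rfl⟩
  exacts [.inl ⟨hH, hH'⟩, .inr ⟨hH, hH'⟩]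

theorem encard_congestionSet_le (hV : V(G).Finite) (hE : E(G).Finite) (hO : D.IsExteriorFace O)
    (he : e ∈ E(G)) :
    (G.congestionSet (G.restrict τ.edgesᶜ) e).encard ≤ D.maxIndexSum + 1 := by
  obtain ⟨F, F', hF⟩ := exists_dual_isLink (D := D) hV hE he
  have hcard : (symmDiff (τ.ancestors F) (τ.ancestors F')).encard ≤ D.maxIndexSum := by
    rcases eq_or_ne F F' with rfl | hne
    · rw [symmDiff_self, bot_eq_empty, encard_empty]
      exact zero_le
    calc (symmDiff (τ.ancestors F) (τ.ancestors F')).encard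
        ≤ (τ.ancestors F).encard + (τ.ancestors F').encard :=
          (encard_le_encard symmDiff_subset_union).trans (encard_union_le _ _)
      _ ≤ graphDist D.dual O F + graphDist D.dual O F' :=
          add_le_add (τ.encard_ancestors_le hF.left_mem) (τ.encard_ancestors_le hF.right_mem)
      _ = D.absoluteIndex F + D.absoluteIndex F' := by
          rw [absoluteIndex_eq_graphDist hV hE hO hF.left_mem,
            absoluteIndex_eq_graphDist hV hE hO hF.right_mem]
      _ ≤ D.maxIndexSum := absoluteIndex_add_le_maxIndexSum hF hne
  calc (G.congestionSet (G.restrict τ.edgesᶜ) e).encard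
      ≤ (insert e (τ.parentEdge '' symmDiff (τ.ancestors F) (τ.ancestors F'))).encard :=
        encard_le_encard (congestionSet_subset τ hV hE hO.1 hF)
    _ ≤ (τ.parentEdge '' symmDiff (τ.ancestors F) (τ.ancestors F')).encard + 1 :=
        encard_insert_le _ _
    _ ≤ D.maxIndexSum + 1 := by gcongr; exact (encard_image_le _ _).trans hcard

end Graph.PlaneDrawing

theorem proposition2 {α β : Type*} (G : Graph α β) (hV : V(G).Finite) (hE : E(G).Finite)
    (hG : G.IsConnected) (D : G.PlaneDrawing) :
    D.maxIndexSum < ⊤ ∧ G.spanningTreeCongestion ≤ D.maxIndexSum + 1 := by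
  refine ⟨Graph.PlaneDrawing.maxIndexSum_lt_top hV hE, ?_⟩
  rcases isEmpty_or_nonempty β with _ | _
  · have hT : G.IsSpanningTree G := ⟨.rfl, hG.isTree fun e => isEmptyElim e⟩
    exact iInf₂_le_of_le G hT (iSup₂_le fun e => isEmptyElim e)
  obtain ⟨O, hO⟩ := Graph.PlaneDrawing.exists_isExteriorFace (D := D) hV hE
  obtain ⟨τ⟩ := SearchTree.nonempty (Graph.PlaneDrawing.isConnected_dual (D := D) hV hE) hO.1
  have hT := Graph.PlaneDrawing.isSpanningTree_restrict_edges_compl τ hV hE hG hO.1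
  exact iInf₂_le_of_le _ hT <| iSup₂_le fun e he =>
    Graph.PlaneDrawing.encard_congestionSet_le τ hV hE hO he.1
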